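/- Let $M\subset\mathbb{R}^2$ be a compact $C^\infty$ embedded one-dimensional submanifold without boundary (a smooth closed curve, possibly with several connected components). Let $\tau$ be its injectivity radius, that is, the supremum of all $r\ge 0$ such that the map $(p,v)\mapsto p+v$, defined on the normal disk bundle $\{(p,v): p\in M,\ v\perp T_pM,\ |v|<r\}$, is an embedding into $\mathbb{R}^2$. Let $\varepsilon\in(0,\tau]$ be a real number, let $S$ be a finite subset of $M$, and let $S^\varepsilon=\bigcup_{x\in S}\{y\in\mathbb{R}^2: |y-x|<\varepsilon\}$ be the union of the open $\varepsilon$-balls around the points of $S$. If $M\subseteq S^\varepsilon$, then the medial axis of $S^\varepsilon$, that is, the set of all points of $S^\varepsilon$ that have at least two closest points in $\mathbb{R}^2\setminus S^\varepsilon$, is homeomorphic to $M$. -/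

import Mathlib

open scoped ContDiff ENNReal NNReal

/-- The Euclidean plane. -/
abbrev Plane : Type := EuclideanSpace ℝ (Fin 2)

/-- `M` is a smooth (`C^∞`) embedded one-dimensional submanifold of the plane without boundary:
around each of its points it is the image of a regular smooth parametrization that is a
homeomorphism from the line onto a relatively open piece of `M`. -/
def IsSmoothCurve (M : Set Plane) : Prop :=
  ∀ p ∈ M, ∃ (U : Set Plane) (γ : ℝ → Plane), IsOpen U ∧ p ∈ U ∧
    ContDiff ℝ ∞ γ ∧ (∀ t, deriv γ t ≠ 0) ∧ Topology.IsEmbedding γ ∧ Set.range γ = M ∩ U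

/-- The tangent vectors of `M` at `p`: velocities at `p` of curves running in `M`. -/
def tangentVectors (M : Set Plane) (p : Plane) : Set Plane :=
  {v | ∃ c : ℝ → Plane, c 0 = p ∧ (∀ᶠ t in nhds (0 : ℝ), c t ∈ M) ∧ HasDerivAt c v 0}

/-- The normal vectors of `M` at `p`: those orthogonal to all tangent vectors. -/
def normalVectors (M : Set Plane) (p : Plane) : Set Plane :=
  {v | ∀ w ∈ tangentVectors M p, inner ℝ v w = 0}

/-- The open normal disk bundle of radius `r`: pairs of a point of `M` and a normal vector there
of length less than `r`. -/
def normalDiskBundle (M : Set Plane) (r : ℝ) : Set (Plane × Plane) :=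
  {q | q.1 ∈ M ∧ q.2 ∈ normalVectors M q.1 ∧ ‖q.2‖ < r}

/-- The normal disk bundle of radius `r` is embedded in the plane by `(p, v) ↦ p + v`. -/
def HasEmbeddedNormalDiskBundle (M : Set Plane) (r : ℝ) : Prop :=
  Topology.IsEmbedding (fun q : normalDiskBundle M r => q.1.1 + q.1.2)

/-- The injectivity radius of `M`: the supremum, possibly infinite, of the radii for which the
normal disk bundle is embedded. -/
noncomputable def injectivityRadius (M : Set Plane) : ℝ≥0∞ :=
  ⨆ (r : ℝ≥0) (_ : HasEmbeddedNormalDiskBundle M r), (r : ℝ≥0∞)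

/-- The union of the open balls of radius `ε` around the points of `S`. -/
def ballUnion (S : Set Plane) (ε : ℝ) : Set Plane :=
  ⋃ x ∈ S, Metric.ball x ε

/-- The points of the set `A` that are closest to `x`. -/
def closestPoints (A : Set Plane) (x : Plane) : Set Plane :=
  {y | y ∈ A ∧ ∀ z ∈ A, dist x y ≤ dist x z}

/-- The medial axis of an open set `O`: the points of `O` that have at least two closest points
in the complement of `O`. -/
def medialAxis (O : Set Plane) : Set Plane :=
  {x | x ∈ O ∧ (closestPoints Oᶜ x).Nontrivial}

/-! The medial axis turns out to be a polygon inscribed in `M`, and nearest-point projection maps it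
homeomorphically onto `M`.

The injectivity radius enters only through one inequality (`inner_le_of_le_injectivityRadius`): an
open disc of radius `ε` tangent to `M` does not meet `M`. Hence a point of `M` within `2 * ε` of `y`
has zero tangential coordinate at `y` only if it is `y` itself, and projection to `M` is continuous
and injective on each chord shorter than `2 * ε`.

Call two samples an edge if both discs of radius `ε` through them are empty of samples. The two
centres are then closest points of the complement for every point of the segment, so edges lie in
the medial axis. The converse (`medialAxis_subset_edgePolygon`) needs that if one of the two discs
is empty and has no sample on its short arc, then so is the other (`le_dist_reflected_center`). A
sample in the second disc would lie with the two endpoints on a circle of radius less than `ε`. On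
such a circle no point of `M` lies between two others in the tangential sense
(`tangent_mul_tangent_nonneg`), whereas of three such points of `M` one always does
(`exists_between`).

Projection is injective on the polygon because the arc over an edge has no sample in its interior
(`mem_endpoints_of_nearest_mem`), so two open arcs that meet belong to the same edge. Rotating an
empty disc about a sample gives an edge on either side of it (`exists_isEdge_right`). Hence the
image of the polygon is open in `M`; it is also compact, and as every point of `M` is joined to a
sample by a projected chord, it is all of `M`. -/

open Filter Topology Asymptotics

/-! ### Coordinates in the plane. -/

/-- Rotation of the plane by a right angle. -/
def quarterTurn (v : Plane) : Plane := !₂[-v 1, v 0]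

theorem plane_inner (u v : Plane) : inner ℝ u v = u 0 * v 0 + u 1 * v 1 := by
  simp [PiLp.inner_apply, Fin.sum_univ_two]; ring

theorem plane_norm_sq (u : Plane) : ‖u‖ ^ 2 = u 0 ^ 2 + u 1 ^ 2 := by
  rw [← real_inner_self_eq_norm_sq, plane_inner]; ring

@[simp] theorem quarterTurn_zero (v : Plane) : quarterTurn v 0 = -v 1 := by simp [quarterTurn]

@[simp] theorem quarterTurn_one (v : Plane) : quarterTurn v 1 = v 0 := by simp [quarterTurn]

theorem norm_quarterTurn (v : Plane) : ‖quarterTurn v‖ = ‖v‖ := by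
  have h : ‖quarterTurn v‖ ^ 2 = ‖v‖ ^ 2 := by
    rw [plane_norm_sq, plane_norm_sq]; simp; ring
  exact (sq_eq_sq₀ (norm_nonneg _) (norm_nonneg _)).1 h

theorem inner_quarterTurn_self (v : Plane) : inner ℝ v (quarterTurn v) = 0 := by
  rw [plane_inner]; simp; ring

theorem smul_eq_of_inner_quarterTurn_eq_zero {u v : Plane} (h : inner ℝ u (quarterTurn v) = 0) :
    ‖v‖ ^ 2 • u = inner ℝ u v • v := by
  rw [plane_inner] at h
  simp only [quarterTurn_zero, quarterTurn_one] at h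
  ext i
  fin_cases i
  · simp [plane_norm_sq, plane_inner]
    linear_combination (-v 1) * h
  · simp [plane_norm_sq, plane_inner]
    linear_combination (v 0) * h

/-! ### Charts, tangent vectors and normal vectors. -/

/-- A regular smooth parametrization of a relatively open piece of `M`. -/
structure IsRegularChart (M : Set Plane) (γ : ℝ → Plane) : Prop where
  contDiff : ContDiff ℝ ∞ γ
  deriv_ne : ∀ t, deriv γ t ≠ 0
  isEmbedding : IsEmbedding γ
  mem : ∀ t, γ t ∈ M
  map_nhds : ∀ t, map γ (𝓝 t) = 𝓝[M] (γ t)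

theorem IsSmoothCurve.exists_chart {M : Set Plane} (hM : IsSmoothCurve M) {y : Plane}
    (hy : y ∈ M) : ∃ γ t, IsRegularChart M γ ∧ γ t = y := by
  obtain ⟨U, γ, hU, hyU, hγ, hd, he, hr⟩ := hM y hy
  obtain ⟨t, ht⟩ : y ∈ Set.range γ := hr ▸ ⟨hy, hyU⟩
  have hm : ∀ t, γ t ∈ M ∩ U := fun t => hr ▸ Set.mem_range_self t
  refine ⟨γ, t, ⟨hγ, hd, he, fun t => (hm t).1, fun t => ?_⟩, ht⟩
  rw [he.map_nhds_eq, hr, nhdsWithin_inter_of_mem']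
  exact mem_nhdsWithin_of_mem_nhds (hU.mem_nhds (hm t).2)

namespace IsRegularChart

variable {M : Set Plane} {γ : ℝ → Plane}

theorem hasDerivAt (h : IsRegularChart M γ) (t : ℝ) : HasDerivAt γ (deriv γ t) t :=
  (h.contDiff.differentiable (by simp) t).hasDerivAt

/-- The normal coordinate has derivative zero in the parameter, and a nonzero velocity makes the
parameter comparable to the chord. Stated along `𝓝[M]`, the estimate applies to any curve in `M`
without lifting it to the chart. -/
theorem isLittleO_normal (h : IsRegularChart M γ) (t : ℝ) :
    (fun z => inner ℝ (z - γ t) (quarterTurn (deriv γ t))) =o[𝓝[M] (γ t)] fun z => z - γ t := by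
  rw [← h.map_nhds, isLittleO_map]
  have h1 : HasDerivAt (fun s => inner ℝ (γ s - γ t) (quarterTurn (deriv γ t))) 0 t := by
    have := ((h.hasDerivAt t).sub_const (γ t)).inner ℝ
      (hasDerivAt_const t (quarterTurn (deriv γ t)))
    simpa [inner_quarterTurn_self] using this
  have h2 := h1.isLittleO
  have h3 := (HasDerivAtFilter.isTheta_sub (h.hasDerivAt t) (h.deriv_ne t)).isBigO_symm
  rw [prod_pure, isBigO_map] at h3
  have h4 : (fun s => inner ℝ (γ s - γ t) (quarterTurn (deriv γ t))) =o[𝓝 t] fun s => s - t := by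
    simpa using h2
  exact h4.trans_isBigO h3

theorem inner_quarterTurn_of_mem_tangentVectors (h : IsRegularChart M γ) {t : ℝ} {v : Plane}
    (hv : v ∈ tangentVectors M (γ t)) : inner ℝ v (quarterTurn (deriv γ t)) = 0 := by
  obtain ⟨c, hc0, hcM, hc⟩ := hv
  have hlim : Tendsto c (𝓝 0) (𝓝[M] (γ t)) :=
    tendsto_nhdsWithin_iff.2 ⟨hc0 ▸ hc.continuousAt, hcM⟩
  have h1 := (h.isLittleO_normal t).comp_tendsto hlim
  have h2 : (fun s => c s - γ t) =O[𝓝 0] fun s => s - 0 := by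
    rw [← hc0]; exact hc.isBigO_sub
  have h3 := h1.trans_isBigO h2
  have h4 : HasDerivAt (fun s => inner ℝ (c s - γ t) (quarterTurn (deriv γ t))) 0 0 := by
    rw [hasDerivAt_iff_isLittleO]
    simpa [hc0, Function.comp_def] using h3
  have h5 : HasDerivAt (fun s => inner ℝ (c s - γ t) (quarterTurn (deriv γ t)))
      (inner ℝ v (quarterTurn (deriv γ t))) 0 := by
    simpa using (hc.sub_const (γ t)).inner ℝ (hasDerivAt_const 0 (quarterTurn (deriv γ t)))
  exact h5.unique h4

end IsRegularChart

theorem exists_unit_tangent {M : Set Plane} (hM : IsSmoothCurve M) :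
    ∃ T : Plane → Plane, ∀ y ∈ M, ‖T y‖ = 1 ∧ T y ∈ tangentVectors M y ∧
      quarterTurn (T y) ∈ normalVectors M y := by
  have key : ∀ y ∈ M, ∃ v : Plane, ‖v‖ = 1 ∧ v ∈ tangentVectors M y ∧
      quarterTurn v ∈ normalVectors M y := by
    intro y hy
    obtain ⟨γ, t, h, rfl⟩ := hM.exists_chart hy
    have hn := norm_ne_zero_iff.2 (h.deriv_ne t)
    refine ⟨‖deriv γ t‖⁻¹ • deriv γ t, ?_, ?_, ?_⟩
    · rw [norm_smul, norm_inv, norm_norm, inv_mul_cancel₀ hn]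
    · refine ⟨fun s => γ (t + ‖deriv γ t‖⁻¹ * s), by simp, Eventually.of_forall fun s => h.mem _, ?_⟩
      have h1 : HasDerivAt (fun s : ℝ => t + ‖deriv γ t‖⁻¹ * s) ‖deriv γ t‖⁻¹ 0 := by
        simpa using ((hasDerivAt_id (0 : ℝ)).const_mul ‖deriv γ t‖⁻¹).const_add t
      exact HasDerivAt.scomp (0 : ℝ) (by simpa using h.hasDerivAt t) h1
    · intro w hw
      have := h.inner_quarterTurn_of_mem_tangentVectors hw
      rw [plane_inner] at this ⊢
      simp at this ⊢
      linear_combination ‖deriv γ t‖⁻¹ * this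
  choose! T hT using key
  exact ⟨T, hT⟩

/-! ### From the injectivity radius to the reach inequality. -/

/-- The curve `M` has the unit tangent field `T`, and its reach is at least `ε`: the open balls of
radius `ε` tangent to `M` do not meet `M`. -/
structure HasTangentReach (M : Set Plane) (ε : ℝ) (T : Plane → Plane) : Prop where
  pos : 0 < ε
  isCompact : IsCompact M
  norm_tangent : ∀ y ∈ M, ‖T y‖ = 1
  reach : ∀ y ∈ M, ∀ a ∈ M, 2 * ε * |inner ℝ (a - y) (quarterTurn (T y))| ≤ ‖a - y‖ ^ 2
  continuousOn : ∀ v, ContinuousOn (fun y => (inner ℝ v (T y) : ℝ) • T y) M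
  inner_of_isLocalExtrOn : ∀ c, ∀ y ∈ M, IsLocalExtrOn (fun z => ‖z - c‖ ^ 2) M y →
    inner ℝ (y - c) (T y) = 0
  exists_chart : ∀ y ∈ M, ∃ γ t, IsRegularChart M γ ∧ γ t = y
  exists_right : ∀ y ∈ M, ∀ δ > 0, ∃ a ∈ M, ‖a - y‖ < δ ∧ 0 < (inner ℝ (a - y) (T y) : ℝ)
  exists_left : ∀ y ∈ M, ∀ δ > 0, ∃ a ∈ M, ‖a - y‖ < δ ∧ (inner ℝ (a - y) (T y) : ℝ) < 0

theorem IsLocalExtrOn.inner_tangentVectors {M : Set Plane} {y v c : Plane}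
    (h : IsLocalExtrOn (fun z => ‖z - c‖ ^ 2) M y) (hv : v ∈ tangentVectors M y) :
    inner ℝ (y - c) v = 0 := by
  obtain ⟨g, hg0, hgM, hg⟩ := hv
  have hlim : Tendsto g (𝓝 0) (𝓝[M] (g 0)) := tendsto_nhdsWithin_iff.2 ⟨hg.continuousAt, hgM⟩
  subst hg0
  have h1 : IsLocalExtr ((fun z => ‖z - c‖ ^ 2) ∘ g) 0 := IsExtrFilter.comp_tendsto h hlim
  have h2 : HasDerivAt ((fun z => ‖z - c‖ ^ 2) ∘ g) (2 * inner ℝ (g 0 - c) v) 0 :=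
    (hg.sub_const c).norm_sq
  linarith [h1.hasDerivAt_eq_zero h2]

theorem sub_mem_normalVectors_of_mem_closestPoints {M : Set Plane} {x y : Plane}
    (hy : y ∈ closestPoints M x) : x - y ∈ normalVectors M y := by
  intro w hw
  have h : IsLocalExtrOn (fun z => ‖z - x‖ ^ 2) M y := by
    left
    filter_upwards [self_mem_nhdsWithin] with z hz
    have := hy.2 z hz
    rw [dist_comm x, dist_comm x, dist_eq_norm, dist_eq_norm] at this
    gcongr
  have := h.inner_tangentVectors hw
  rw [← neg_sub, inner_neg_left, this, neg_zero]

theorem IsCompact.exists_mem_closestPoints {M : Set Plane} (hM : IsCompact M) (hne : M.Nonempty)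
    (x : Plane) : ∃ y, y ∈ closestPoints M x := by
  obtain ⟨y, hy, h⟩ := hM.exists_isMinOn hne (f := fun z => dist x z) (by fun_prop)
  exact ⟨y, hy, fun z hz => h hz⟩

/-- If `a` were inside the tangent disc at `y` with normal `n`, then for a radius `r` slightly below
`ε` the centre `y + r • n` would have a nearest point other than `y`. That centre would then be the
image of two elements of an embedded normal disk bundle. -/
theorem inner_le_of_le_injectivityRadius {M : Set Plane} (hM : IsCompact M) {ε : ℝ} (hε : 0 < ε)
    (hετ : ENNReal.ofReal ε ≤ injectivityRadius M) {y a n : Plane} (hy : y ∈ M) (ha : a ∈ M)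
    (hn : n ∈ normalVectors M y) (hn1 : ‖n‖ = 1) : 2 * ε * inner ℝ (a - y) n ≤ ‖a - y‖ ^ 2 := by
  by_contra! hlt
  set k : ℝ := inner ℝ (a - y) n with hk
  have hkpos : 0 < k := by
    by_contra! h
    nlinarith [sq_nonneg ‖a - y‖]
  -- The lower bound on `r` says exactly that `a` is still inside the tangent disc of radius `r`.
  obtain ⟨r, hr1, hrε⟩ := exists_between (show ‖a - y‖ ^ 2 / (2 * k) < ε by
    rw [div_lt_iff₀ (by positivity)]; linarith)
  have hr0 : 0 < r := lt_of_le_of_lt (by positivity) hr1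
  rw [div_lt_iff₀ (by positivity)] at hr1
  obtain ⟨r', hr'⟩ := lt_iSup_iff.1 (((ENNReal.ofReal_lt_ofReal_iff hε).2 hrε).trans_le hετ)
  obtain ⟨hemb, hrr⟩ := lt_iSup_iff.1 hr'
  have hrr' : r < r' := by
    rwa [← ENNReal.ofReal_coe_nnreal, ENNReal.ofReal_lt_ofReal_iff_of_nonneg hr0.le] at hrr
  obtain ⟨y', hy'⟩ := hM.exists_mem_closestPoints ⟨y, hy⟩ (y + r • n)
  have hxa : ‖a - (y + r • n)‖ < r := by
    have h1 : ‖a - (y + r • n)‖ ^ 2 = ‖a - y‖ ^ 2 - 2 * r * k + r ^ 2 := by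
      rw [← sub_sub, norm_sub_sq_real, inner_smul_right, norm_smul, hn1, ← hk, mul_one,
        Real.norm_eq_abs, sq_abs]
      ring
    have h2 : ‖a - (y + r • n)‖ ^ 2 < r ^ 2 := by rw [h1]; linarith
    exact lt_of_pow_lt_pow_left₀ 2 hr0.le h2
  have hxy' : ‖y + r • n - y'‖ < r := by
    have := hy'.2 a ha
    rw [dist_eq_norm, dist_comm, dist_eq_norm] at this
    exact this.trans_lt hxa
  let q1 : normalDiskBundle M r' := ⟨(y, r • n), hy, fun w hw => by
    rw [inner_smul_left, hn w hw, mul_zero], by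
      rw [norm_smul, hn1, mul_one, Real.norm_eq_abs, abs_of_pos hr0]; exact hrr'⟩
  let q2 : normalDiskBundle M r' := ⟨(y', y + r • n - y'), hy'.1,
    sub_mem_normalVectors_of_mem_closestPoints hy', hxy'.trans hrr'⟩
  have heq : q1 = q2 := hemb.injective (by simp [q1, q2])
  have hyy : y = y' := congrArg (fun q => q.1.1) heq
  rw [← hyy, add_sub_cancel_left, norm_smul, hn1, mul_one, Real.norm_eq_abs, abs_of_pos hr0] at hxy'
  exact lt_irrefl _ hxy'

/-- `T` is chosen pointwise with arbitrary signs and need not be continuous. The projection to the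
tangent line does not see the sign, and in a chart it is given by the velocity. -/
theorem continuousOn_tangent {M : Set Plane} (hM : IsSmoothCurve M) {T : Plane → Plane}
    (hT1 : ∀ y ∈ M, ‖T y‖ = 1) (hT : ∀ y ∈ M, T y ∈ tangentVectors M y) (v : Plane) :
    ContinuousOn (fun y => (inner ℝ v (T y) : ℝ) • T y) M := by
  intro y hy
  obtain ⟨γ, t, h, rfl⟩ := hM.exists_chart hy
  have hform : ∀ s, (inner ℝ v (T (γ s)) : ℝ) • T (γ s) =
      (inner ℝ v (deriv γ s) / ‖deriv γ s‖ ^ 2) • deriv γ s := by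
    intro s
    have h1 := h.inner_quarterTurn_of_mem_tangentVectors (hT _ (h.mem s))
    have h2 := smul_eq_of_inner_quarterTurn_eq_zero h1
    have hn : ‖deriv γ s‖ ^ 2 ≠ 0 := pow_ne_zero 2 (norm_ne_zero_iff.2 (h.deriv_ne s))
    set k : ℝ := inner ℝ (T (γ s)) (deriv γ s) / ‖deriv γ s‖ ^ 2 with hk
    have h3 : T (γ s) = k • deriv γ s := by
      rw [hk, div_eq_inv_mul, mul_smul, ← h2, smul_smul, inv_mul_cancel₀ hn, one_smul]
    have h4 : k ^ 2 * ‖deriv γ s‖ ^ 2 = 1 := by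
      have := hT1 _ (h.mem s)
      rw [h3, norm_smul] at this
      rw [← mul_pow, ← sq_abs, abs_mul, abs_norm, ← Real.norm_eq_abs, this, one_pow]
    rw [h3, inner_smul_right, smul_smul]
    congr 1
    rw [eq_div_iff hn]
    linear_combination (inner ℝ v (deriv γ s)) * h4
  rw [ContinuousWithinAt, ← h.map_nhds, tendsto_map'_iff]
  have hd : Continuous (deriv γ) := h.contDiff.continuous_deriv (by simp)
  have hc : Continuous fun s => (inner ℝ v (deriv γ s) / ‖deriv γ s‖ ^ 2) • deriv γ s :=
    ((continuous_const.inner hd).div (hd.norm.pow 2) fun s =>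
      pow_ne_zero 2 (norm_ne_zero_iff.2 (h.deriv_ne s))).smul hd
  simp only [Function.comp_def, hform]
  exact hc.tendsto t

theorem exists_right_of_mem_tangentVectors {M : Set Plane} {y v : Plane}
    (hv : v ∈ tangentVectors M y) (hv0 : v ≠ 0) {δ : ℝ} (hδ : 0 < δ) :
    ∃ a ∈ M, ‖a - y‖ < δ ∧ 0 < (inner ℝ (a - y) v : ℝ) := by
  by_contra! hno
  obtain ⟨g, hg0, hgM, hg⟩ := hv
  have h1 : IsLocalMax (fun s => (inner ℝ (g s - y) v : ℝ)) 0 := by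
    have h2 : ∀ᶠ s in 𝓝 (0 : ℝ), ‖g s - y‖ < δ := by
      have := hg.continuousAt (Metric.ball_mem_nhds (g 0) hδ)
      filter_upwards [this] with s hs
      rwa [← hg0, ← dist_eq_norm]
    filter_upwards [h2, hgM] with s hs hsM
    simpa [hg0] using hno _ hsM hs
  have h3 : HasDerivAt (fun s => (inner ℝ (g s - y) v : ℝ)) (inner ℝ v v) 0 := by
    simpa using (hg.sub_const y).inner ℝ (hasDerivAt_const 0 v)
  exact hv0 (inner_self_eq_zero.1 (h1.hasDerivAt_eq_zero h3))

theorem neg_mem_tangentVectors {M : Set Plane} {y v : Plane} (hv : v ∈ tangentVectors M y) :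
    -v ∈ tangentVectors M y := by
  obtain ⟨g, hg0, hgM, hg⟩ := hv
  refine ⟨fun s => g (-s), by simpa, ?_, ?_⟩
  · have : Tendsto (fun s : ℝ => -s) (𝓝 0) (𝓝 0) := by
      simpa using (continuous_neg (G := ℝ)).tendsto 0
    exact this.eventually hgM
  · have := HasDerivAt.scomp (0 : ℝ) (by simpa using hg) (hasDerivAt_neg (0 : ℝ))
    simpa [Function.comp_def] using this

theorem exists_hasTangentReach {M : Set Plane} (hM : IsCompact M) (hcurve : IsSmoothCurve M) {ε : ℝ}
    (hε : 0 < ε) (hετ : ENNReal.ofReal ε ≤ injectivityRadius M) :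
    ∃ T, HasTangentReach M ε T := by
  obtain ⟨T, hT⟩ := exists_unit_tangent hcurve
  refine ⟨T, hε, hM, fun y hy => (hT y hy).1, fun y hy a ha => ?_, fun v =>
    continuousOn_tangent hcurve (fun y hy => (hT y hy).1) (fun y hy => (hT y hy).2.1) v,
    fun c y hy h => h.inner_tangentVectors (hT y hy).2.1, fun y hy => hcurve.exists_chart hy,
    fun y hy δ hδ => ?_, fun y hy δ hδ => ?_⟩
  · have hn1 : ‖quarterTurn (T y)‖ = 1 := by rw [norm_quarterTurn, (hT y hy).1]
    have h1 := inner_le_of_le_injectivityRadius hM hε hετ hy ha (hT y hy).2.2 hn1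
    have hneg : -quarterTurn (T y) ∈ normalVectors M y := fun w hw => by
      rw [inner_neg_left, (hT y hy).2.2 w hw, neg_zero]
    have h2 := inner_le_of_le_injectivityRadius hM hε hετ hy ha hneg (by rwa [norm_neg])
    rw [inner_neg_right] at h2
    rcases abs_cases (inner ℝ (a - y) (quarterTurn (T y)) : ℝ) with ⟨h, -⟩ | ⟨h, -⟩ <;> rw [h]
    exacts [h1, h2]
  · refine exists_right_of_mem_tangentVectors (hT y hy).2.1 ?_ hδ
    rw [← norm_ne_zero_iff, (hT y hy).1]; exact one_ne_zero
  · obtain ⟨a, ha, h1, h2⟩ := exists_right_of_mem_tangentVectors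
      (neg_mem_tangentVectors (hT y hy).2.1) (by
        rw [← norm_ne_zero_iff, norm_neg, (hT y hy).1]; exact one_ne_zero) hδ
    exact ⟨a, ha, h1, by rwa [inner_neg_right, neg_pos] at h2⟩

theorem inner_eq_of_unit {t : Plane} (ht : ‖t‖ = 1) (u v : Plane) :
    (inner ℝ u v : ℝ) = inner ℝ u t * inner ℝ v t +
      inner ℝ u (quarterTurn t) * inner ℝ v (quarterTurn t) := by
  have h : t 0 ^ 2 + t 1 ^ 2 = 1 := by rw [← plane_norm_sq, ht, one_pow]
  simp only [plane_inner, quarterTurn_zero, quarterTurn_one]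
  linear_combination (-(u 0 * v 0 + u 1 * v 1)) * h

/-! ### Nearest points and the projection of short chords. -/

/-- A point of `M` nearest to `x`. -/
noncomputable def nearest (M : Set Plane) (x : Plane) : Plane :=
  Classical.epsilon fun y => y ∈ closestPoints M x

/-- The projection to `M` of the segment from `a` to `b`. -/
def projectedArc (M : Set Plane) (a b : Plane) : Set Plane := nearest M '' segment ℝ a b

theorem dist_add_dist_of_mem_segment' {a b w : Plane} (hw : w ∈ segment ℝ a b) :
    dist w a + dist w b = dist a b := by
  rw [dist_comm w a]; exact dist_add_dist_of_mem_segment hw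

namespace HasTangentReach

variable {M : Set Plane} {ε : ℝ} {T : Plane → Plane} (h : HasTangentReach M ε T)
include h

theorem inner_sub_of_mem_closestPoints {x y : Plane} (hy : y ∈ closestPoints M x) :
    inner ℝ (x - y) (T y) = 0 := by
  have hl : IsLocalExtrOn (fun z => ‖z - x‖ ^ 2) M y := by
    left
    filter_upwards [self_mem_nhdsWithin] with z hz
    have := hy.2 z hz
    rw [dist_comm x, dist_comm x, dist_eq_norm, dist_eq_norm] at this
    gcongr
  rw [← neg_sub, inner_neg_left, h.inner_of_isLocalExtrOn x y hy.1 hl, neg_zero]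

theorem inner_normal_le {y a u : Plane} (hy : y ∈ M) (ha : a ∈ M) (hu : inner ℝ u (T y) = 0) :
    2 * ε * inner ℝ u (a - y) ≤ ‖u‖ * ‖a - y‖ ^ 2 := by
  have h1 := h.norm_tangent y hy
  have h2 : ‖u‖ = |inner ℝ u (quarterTurn (T y))| := by
    have := inner_eq_of_unit h1 u u
    rw [hu, real_inner_self_eq_norm_sq, zero_mul, zero_add, ← sq] at this
    exact (sq_eq_sq₀ (norm_nonneg _) (abs_nonneg _)).1 (by rw [this, sq_abs])
  rw [inner_eq_of_unit h1, hu, zero_mul, zero_add, h2]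
  have h3 := h.reach y hy a ha
  calc _ ≤ 2 * ε * |inner ℝ u (quarterTurn (T y)) * inner ℝ (a - y) (quarterTurn (T y))| := by
        have := h.pos
        gcongr
        exact le_abs_self _
    _ = |inner ℝ u (quarterTurn (T y))| * (2 * ε * |inner ℝ (a - y) (quarterTurn (T y))|) := by
        rw [abs_mul]; ring
    _ ≤ _ := by gcongr

/-- Here `a - y` is itself normal at `y`, so the reach inequality reads `2 * ε * ‖a - y‖ ^ 2 ≤ ‖a -
y‖ ^ 3`. -/
theorem eq_of_inner_eq_zero {y a : Plane} (hy : y ∈ M) (ha : a ∈ M) (hd : dist a y < 2 * ε)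
    (h0 : inner ℝ (a - y) (T y) = 0) : a = y := by
  have h1 := h.inner_normal_le hy ha h0
  rw [real_inner_self_eq_norm_sq] at h1
  rw [dist_eq_norm] at hd
  by_contra hne
  have : 0 < ‖a - y‖ := norm_pos_iff.2 (sub_ne_zero.2 hne)
  have : 0 < ‖a - y‖ ^ 2 := by positivity
  nlinarith

/-- A Lipschitz bound for the projection at points closer than `ε` to `M`: add the reach
inequalities at `y` towards `y'` and at `y'` towards `y`. -/
theorem dist_closestPoints_le {x y x' y' : Plane} (hy : y ∈ closestPoints M x)
    (hy' : y' ∈ closestPoints M x') :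
    (2 * ε - dist x y - dist x' y') * dist y y' ≤ 2 * ε * dist x x' := by
  have h1 := h.inner_normal_le hy.1 hy'.1 (h.inner_sub_of_mem_closestPoints hy)
  have h2 := h.inner_normal_le hy'.1 hy.1 (h.inner_sub_of_mem_closestPoints hy')
  have h3 : (inner ℝ (x - y) (y' - y) : ℝ) + inner ℝ (x' - y') (y - y') =
      ‖y - y'‖ ^ 2 - inner ℝ (x - x') (y - y') := by
    rw [plane_norm_sq]; simp only [plane_inner, PiLp.sub_apply]; ring
  have h4 := real_inner_le_norm (x - x') (y - y')
  rw [norm_sub_rev y' y] at h1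
  simp only [dist_eq_norm]
  have h5 : ((2 * ε - ‖x - y‖ - ‖x' - y'‖) * ‖y - y'‖) * ‖y - y'‖ ≤
      (2 * ε * ‖x - x'‖) * ‖y - y'‖ := by nlinarith [h.pos]
  rcases (norm_nonneg (y - y')).eq_or_lt with h0 | h0
  · rw [← h0, mul_zero]
    have := h.pos
    positivity
  · exact le_of_mul_le_mul_right h5 h0

theorem nearest_mem_closestPoints {x a : Plane} (ha : a ∈ M) :
    nearest M x ∈ closestPoints M x :=
  Classical.epsilon_spec (h.isCompact.exists_mem_closestPoints ⟨a, ha⟩ x)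

theorem nearest_mem {x a : Plane} (ha : a ∈ M) : nearest M x ∈ M :=
  (h.nearest_mem_closestPoints ha).1

theorem dist_nearest_le {x a : Plane} (ha : a ∈ M) : dist x (nearest M x) ≤ dist x a :=
  (h.nearest_mem_closestPoints ha).2 a ha

theorem nearest_self {a : Plane} (ha : a ∈ M) : nearest M a = a := by
  have := h.dist_nearest_le (x := a) ha
  rw [dist_self] at this
  exact (dist_le_zero.1 this).symm

theorem inner_sub_nearest {x a : Plane} (ha : a ∈ M) :
    inner ℝ (x - nearest M x) (T (nearest M x)) = 0 :=
  h.inner_sub_of_mem_closestPoints (h.nearest_mem_closestPoints ha)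

theorem continuousAt_nearest {x a : Plane} (ha : a ∈ M) (hd : dist x a < ε) :
    ContinuousAt (nearest M) x := by
  have hx := (h.dist_nearest_le ha).trans_lt hd
  have hε := h.pos
  set k := (ε - dist x (nearest M x)) / 2 with hk
  have hk0 : 0 < k := by rw [hk]; linarith
  have hball : ∀ᶠ x' in 𝓝 x, dist x' x < k := Metric.ball_mem_nhds x hk0
  have hbound : ∀ᶠ x' in 𝓝 x, dist (nearest M x') (nearest M x) ≤ 2 * ε / k * dist x' x := by
    filter_upwards [hball] with x' hx'
    have h1 := h.dist_closestPoints_le (h.nearest_mem_closestPoints (x := x') ha)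
      (h.nearest_mem_closestPoints (x := x) ha)
    have h2 : dist x' (nearest M x') ≤ dist x' x + dist x (nearest M x) :=
      (h.dist_nearest_le (h.nearest_mem ha)).trans (dist_triangle _ _ _)
    have h3 : k ≤ 2 * ε - dist x' (nearest M x') - dist x (nearest M x) := by
      rw [hk] at hx' ⊢; linarith
    rw [div_mul_eq_mul_div, le_div_iff₀ hk0, mul_comm]
    exact (mul_le_mul_of_nonneg_right h3 dist_nonneg).trans h1
  refine tendsto_iff_dist_tendsto_zero.2 (squeeze_zero' (Eventually.of_forall fun _ => dist_nonneg)
    hbound ?_)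
  have : Tendsto (fun x' => 2 * ε / k * dist x' x) (𝓝 x) (𝓝 (2 * ε / k * dist x x)) :=
    (continuous_const.mul (continuous_id.dist continuous_const)).tendsto x
  simpa using this

section Segment

variable {a b w : Plane} (ha : a ∈ M) (hb : b ∈ M) (hab : dist a b < 2 * ε)
include ha hb

/-- Every point of a chord shorter than `2 * ε` is within `ε` of an endpoint. -/
theorem continuousAt_nearest_of_mem_segment (hab : dist a b < 2 * ε) (hw : w ∈ segment ℝ a b) :
    ContinuousAt (nearest M) w := by
  have := dist_add_dist_of_mem_segment' hw
  rcases le_total (dist w a) (dist w b) with hle | hle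
  · exact h.continuousAt_nearest ha (by linarith)
  · exact h.continuousAt_nearest hb (by linarith)

omit ha in
theorem dist_nearest_left_le (hw : w ∈ segment ℝ a b) : dist (nearest M w) a ≤ dist a b := by
  have h1 := dist_add_dist_of_mem_segment' hw
  have h2 := h.dist_nearest_le (x := w) hb
  linarith [dist_triangle_left (nearest M w) a w]

omit hb in
theorem dist_nearest_right_le (hw : w ∈ segment ℝ a b) : dist (nearest M w) b ≤ dist a b := by
  have h1 := dist_add_dist_of_mem_segment' hw
  have h2 := h.dist_nearest_le (x := w) ha
  linarith [dist_triangle_left (nearest M w) b w]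

include hab

/-- Let `y` be the projection of `w`. As `w - y` is normal at `y`, a chord normal at `y` would make
both `a - y` and `b - y` normal, which forces `a = y = b`. -/
theorem inner_chord_ne_zero (hne : a ≠ b) (hw : w ∈ segment ℝ a b) :
    (inner ℝ (b - a) (T (nearest M w)) : ℝ) ≠ 0 := by
  intro h0
  have h1 := h.inner_sub_nearest (x := w) ha
  rw [segment_eq_image_lineMap] at hw
  obtain ⟨t, ht, rfl⟩ := hw
  have hw : AffineMap.lineMap a b t ∈ segment ℝ a b := by
    rw [segment_eq_image_lineMap]; exact ⟨t, ht, rfl⟩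
  set y := nearest M (AffineMap.lineMap a b t)
  have h2 : a - y = (AffineMap.lineMap a b t - y) - t • (b - a) := by
    rw [AffineMap.lineMap_apply_module']; abel
  have h3 : b - y = (AffineMap.lineMap a b t - y) + (1 - t) • (b - a) := by
    rw [AffineMap.lineMap_apply_module']; module
  have hay : a = y := h.eq_of_inner_eq_zero (h.nearest_mem ha) ha
    (by rw [dist_comm]; exact (h.dist_nearest_left_le hb hw).trans_lt hab)
    (by rw [h2, inner_sub_left, h1, inner_smul_left, h0]; simp)
  have hby : b = y := h.eq_of_inner_eq_zero (h.nearest_mem ha) hb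
    (by rw [dist_comm]; exact (h.dist_nearest_right_le ha hw).trans_lt hab)
    (by rw [h3, inner_add_left, h1, inner_smul_left, h0]; simp)
  exact hne (hay.trans hby.symm)

theorem injOn_nearest_segment : Set.InjOn (nearest M) (segment ℝ a b) := by
  intro w hw w' hw' heq
  by_contra hne
  have hab' : a ≠ b := by
    rintro rfl
    rw [segment_same] at hw hw'
    exact hne (hw.trans hw'.symm)
  refine h.inner_chord_ne_zero ha hb hab hab' hw ?_
  have h1 := h.inner_sub_nearest (x := w) ha
  have h2 := h.inner_sub_nearest (x := w') ha
  rw [← heq] at h2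
  have h3 : inner ℝ (w - w') (T (nearest M w)) = 0 := by
    rw [← sub_sub_sub_cancel_right w w' (nearest M w), inner_sub_left, h1, h2, sub_zero]
  rw [segment_eq_image_lineMap] at hw hw'
  obtain ⟨t, ht, rfl⟩ := hw
  obtain ⟨t', ht', rfl⟩ := hw'
  have h4 : AffineMap.lineMap a b t - AffineMap.lineMap a b t' = (t - t') • (b - a) := by
    rw [AffineMap.lineMap_apply_module', AffineMap.lineMap_apply_module']; module
  rw [h4, inner_smul_left] at h3
  rcases mul_eq_zero.1 h3 with h5 | h5
  · exact absurd (congrArg (AffineMap.lineMap a b) (sub_eq_zero.1 h5)) hne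
  · exact h5

omit hb hab in
theorem projectedArc_subset : projectedArc M a b ⊆ M := by
  rintro _ ⟨w, -, rfl⟩
  exact h.nearest_mem ha

theorem continuousOn_nearest_segment : ContinuousOn (nearest M) (segment ℝ a b) :=
  fun _ hw => (h.continuousAt_nearest_of_mem_segment ha hb hab hw).continuousWithinAt

theorem isCompact_projectedArc : IsCompact (projectedArc M a b) := by
  refine IsCompact.image_of_continuousOn ?_ (h.continuousOn_nearest_segment ha hb hab)
  rw [segment_eq_image_lineMap]
  exact isCompact_Icc.image AffineMap.lineMap_continuous

theorem isPreconnected_projectedArc : IsPreconnected (projectedArc M a b) :=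
  (convex_segment a b).isPreconnected.image _ (h.continuousOn_nearest_segment ha hb hab)

omit hb hab in
theorem left_mem_projectedArc : a ∈ projectedArc M a b :=
  ⟨a, left_mem_segment ℝ a b, h.nearest_self ha⟩

omit ha hab in
theorem right_mem_projectedArc : b ∈ projectedArc M a b :=
  ⟨b, right_mem_segment ℝ a b, h.nearest_self hb⟩

end Segment

end HasTangentReach

/-! ### Betweenness on the curve and discs through two of its points. -/

theorem plane_dist_sq (u v : Plane) : dist u v ^ 2 = (u 0 - v 0) ^ 2 + (u 1 - v 1) ^ 2 := by
  rw [dist_eq_norm, plane_norm_sq]; simp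

theorem dist_lineMap_sq (z a b : Plane) (s : ℝ) :
    dist z (AffineMap.lineMap a b s) ^ 2 =
      (1 - s) * dist z a ^ 2 + s * dist z b ^ 2 - s * (1 - s) * dist a b ^ 2 := by
  simp only [plane_dist_sq, AffineMap.lineMap_apply_module', PiLp.add_apply, PiLp.smul_apply,
    PiLp.sub_apply, smul_eq_mul]
  ring

theorem mem_segment_iff_lineMap {a b w : Plane} :
    w ∈ segment ℝ a b ↔ ∃ s ∈ Set.Icc (0 : ℝ) 1, AffineMap.lineMap a b s = w := by
  rw [segment_eq_image_lineMap]; rfl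

theorem two_mul_inner_sub_eq_of_dist_eq {c u v : Plane} (hd : dist c u = dist c v) :
    2 * (inner ℝ (c - v) (u - v) : ℝ) = ‖u - v‖ ^ 2 := by
  have h1 : dist c u ^ 2 = dist c v ^ 2 := by rw [hd]
  rw [plane_dist_sq, plane_dist_sq] at h1
  rw [plane_inner, plane_norm_sq]
  simp only [PiLp.sub_apply]
  linear_combination -h1

namespace HasTangentReach

variable {M : Set Plane} {ε : ℝ} {T : Plane → Plane} (h : HasTangentReach M ε T)
include h

/-- No point of `M` on a circle of radius less than `ε` is between two others. Equal distances turn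
the reach inequality at `v` into `(ε - |C_N|) * |U_N| ≤ C_T * U_T`, where the subscripts denote
tangential and normal coordinates at `v`, `C = c - v` and `U = u - v`. So every `U_T` has the sign
of `C_T`, and `C_T = 0` forces `U = 0`. -/
theorem tangent_mul_tangent_nonneg {u v w c : Plane} (hu : u ∈ M) (hv : v ∈ M) (hw : w ∈ M)
    (hcu : dist c u = dist c v) (hcw : dist c w = dist c v) (hc : dist c v < ε) :
    0 ≤ (inner ℝ (u - v) (T v) * inner ℝ (w - v) (T v) : ℝ) := by
  by_contra! hneg
  have h1 := h.norm_tangent v hv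
  set N := quarterTurn (T v) with hN
  have hCN : |(inner ℝ (c - v) N : ℝ)| < ε := by
    refine lt_of_le_of_lt (abs_real_inner_le_norm _ _) ?_
    rwa [hN, norm_quarterTurn, h1, mul_one, ← dist_eq_norm]
  have key : ∀ a ∈ M, dist c a = dist c v →
      (ε - |(inner ℝ (c - v) N : ℝ)|) * |(inner ℝ (a - v) N : ℝ)| ≤
        inner ℝ (c - v) (T v) * inner ℝ (a - v) (T v) := by
    intro a ha hca
    have h2 := h.reach v hv a ha
    rw [← two_mul_inner_sub_eq_of_dist_eq hca, inner_eq_of_unit h1 (c - v) (a - v)] at h2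
    have h3 := le_abs_self (inner ℝ (c - v) N * inner ℝ (a - v) N : ℝ)
    rw [abs_mul] at h3
    rw [← hN] at h2
    linarith
  have hU := key u hu hcu
  have hW := key w hw hcw
  have h4 : 0 ≤ (ε - |(inner ℝ (c - v) N : ℝ)|) * |(inner ℝ (u - v) N : ℝ)| :=
    mul_nonneg (by linarith) (abs_nonneg _)
  have h5 : 0 ≤ (ε - |(inner ℝ (c - v) N : ℝ)|) * |(inner ℝ (w - v) N : ℝ)| :=
    mul_nonneg (by linarith) (abs_nonneg _)
  have hC : (inner ℝ (c - v) (T v) : ℝ) = 0 := by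
    have h6 := mul_nonneg (h4.trans hU) (h5.trans hW)
    by_contra hne
    have : 0 < (inner ℝ (c - v) (T v) : ℝ) ^ 2 := by positivity
    nlinarith
  rw [hC, zero_mul] at hU
  have h7 : |(inner ℝ (u - v) N : ℝ)| = 0 := by
    refine le_antisymm (nonpos_of_mul_nonpos_right hU (by linarith)) (abs_nonneg _)
  have h8 := two_mul_inner_sub_eq_of_dist_eq hcu
  rw [inner_eq_of_unit h1, ← hN, hC, abs_eq_zero.1 h7] at h8
  have h9 : u - v = 0 := norm_eq_zero.1 (pow_eq_zero_iff two_ne_zero |>.1 (by linarith))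
  rw [h9, inner_zero_left, zero_mul] at hneg
  exact lt_irrefl _ hneg

/-- If `c` is on the arc over the chord, its normal line separates `a` from `b`. Otherwise `⟨b - a,
T y⟩ * ⟨c - y, T y⟩` has no zero on the connected arc, hence one sign. A negative sign puts `a`
between the others, a positive one `b`. The product is independent of the sign of `T`. -/
theorem exists_between {a b c : Plane} (ha : a ∈ M) (hb : b ∈ M) (hc : c ∈ M)
    (hab : dist a b < 2 * ε) (hne : a ≠ b) (hca : c ≠ a) (hcb : c ≠ b)
    (hd : ∀ y ∈ projectedArc M a b, dist c y < 2 * ε) :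
    (inner ℝ (b - a) (T a) * inner ℝ (c - a) (T a) : ℝ) < 0 ∨
    (inner ℝ (a - b) (T b) * inner ℝ (c - b) (T b) : ℝ) < 0 ∨
    (inner ℝ (a - c) (T c) * inner ℝ (b - c) (T c) : ℝ) < 0 := by
  by_cases hmem : c ∈ projectedArc M a b
  · obtain ⟨w, hw, rfl⟩ := hmem
    right; right
    have h0 := h.inner_chord_ne_zero ha hb hab hne hw
    have h1 := h.inner_sub_nearest (x := w) ha
    obtain ⟨s, hs, rfl⟩ := mem_segment_iff_lineMap.1 hw
    set y := nearest M (AffineMap.lineMap a b s)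
    have hs0 : s ≠ 0 := by
      rintro rfl; simp only [y, AffineMap.lineMap_apply_zero] at hca; exact hca (h.nearest_self ha)
    have hs1 : s ≠ 1 := by
      rintro rfl; simp only [y, AffineMap.lineMap_apply_one] at hcb; exact hcb (h.nearest_self hb)
    have h2 : a - y = (AffineMap.lineMap a b s - y) - s • (b - a) := by
      rw [AffineMap.lineMap_apply_module']; abel
    have h3 : b - y = (AffineMap.lineMap a b s - y) + (1 - s) • (b - a) := by
      rw [AffineMap.lineMap_apply_module']; module
    rw [h2, h3, inner_sub_left, inner_add_left, h1, inner_smul_left, inner_smul_left]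
    simp only [conj_trivial, zero_sub, zero_add]
    have hs2 : 0 < s := lt_of_le_of_ne hs.1 (Ne.symm hs0)
    have hs3 : 0 < 1 - s := sub_pos.2 (lt_of_le_of_ne hs.2 hs1)
    have h4 : 0 < (inner ℝ (b - a) (T y) : ℝ) ^ 2 := by positivity
    have h5 := mul_pos (mul_pos hs2 hs3) h4
    linarith
  · set g : Plane → ℝ := fun y => inner ℝ (c - y) ((inner ℝ (b - a) (T y) : ℝ) • T y) with hg
    have hgform : ∀ y, g y = inner ℝ (b - a) (T y) * inner ℝ (c - y) (T y) := fun y => by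
      rw [hg]; simp only [inner_smul_right]
    have hgc : ContinuousOn g (projectedArc M a b) :=
      ((continuousOn_const.sub continuousOn_id).inner (h.continuousOn (b - a))).mono
        (h.projectedArc_subset ha)
    have hg0 : ∀ y ∈ projectedArc M a b, g y ≠ 0 := by
      intro y hy h0
      rw [hgform] at h0
      rcases mul_eq_zero.1 h0 with h1 | h1
      · obtain ⟨w, hw, rfl⟩ := hy
        exact h.inner_chord_ne_zero ha hb hab hne hw h1
      · exact hmem (h.eq_of_inner_eq_zero (h.projectedArc_subset ha hy) hc (hd y hy) h1 ▸ hy)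
    have hpre := h.isPreconnected_projectedArc ha hb hab
    have hma := h.left_mem_projectedArc (b := b) ha
    have hmb := h.right_mem_projectedArc (a := a) hb
    rcases lt_or_gt_of_ne (hg0 a hma) with h1 | h1
    · left; rwa [hgform] at h1
    · right; left
      have h2 : 0 < g b := by
        by_contra! hle
        obtain ⟨y, hy, h0⟩ := hpre.intermediate_value hmb hma hgc ⟨hle, h1.le⟩
        exact hg0 y hy h0
      rw [hgform] at h2
      rw [← neg_sub, inner_neg_left]
      linarith

/-- By Stewart's formula `dist z w ^ 2 = ε ^ 2 - s * (1 - s) * dist a b ^ 2`. Averaging the reach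
inequalities towards `a` and `b` at the projection of `w`, at distance `t` from `w`, gives `s * (1 -
s) * dist a b ^ 2 ≥ 2 * ε * t - t ^ 2`. Consequently the arc over the chord lies in both closed
discs of radius `ε` through `a` and `b`. -/
theorem dist_center_le {a b w z : Plane} (ha : a ∈ M) (hb : b ∈ M) (hab : dist a b < 2 * ε)
    (hw : w ∈ segment ℝ a b) (hza : dist z a = ε) (hzb : dist z b = ε) :
    dist z w ≤ ε - dist w (nearest M w) := by
  have hε := h.pos
  have hy := h.nearest_mem (x := w) ha
  have h0 := h.inner_sub_nearest (x := w) ha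
  have h1 := h.inner_normal_le hy ha h0
  have h2 := h.inner_normal_le hy hb h0
  have ht : dist w (nearest M w) < ε := by
    have := dist_add_dist_of_mem_segment' hw
    linarith [h.dist_nearest_le (x := w) ha, h.dist_nearest_le (x := w) hb]
  obtain ⟨s, hs, rfl⟩ := mem_segment_iff_lineMap.1 hw
  set w := AffineMap.lineMap a b s with hwdef
  set y := nearest M w
  have h3 := dist_lineMap_sq z a b s
  have h4 := dist_lineMap_sq y a b s
  rw [← hwdef, hza, hzb] at h3
  rw [← hwdef, dist_comm y, dist_comm y a, dist_comm y b] at h4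
  have h5 : (1 - s) * (inner ℝ (w - y) (a - y) : ℝ) + s * inner ℝ (w - y) (b - y) = dist w y ^ 2 := by
    rw [dist_eq_norm, ← real_inner_self_eq_norm_sq]
    have : w - y = (1 - s) • (a - y) + s • (b - y) := by
      rw [hwdef, AffineMap.lineMap_apply_module']; module
    conv_rhs => rw [this, inner_add_right, inner_smul_right, inner_smul_right, ← this]
  rw [← dist_eq_norm, ← dist_eq_norm] at h1 h2
  have h6 : 2 * ε * dist w y ^ 2 ≤ dist w y * (dist w y ^ 2 + s * (1 - s) * dist a b ^ 2) := by
    have h7 := mul_le_mul_of_nonneg_left h1 (sub_nonneg.2 hs.2)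
    have h8 := mul_le_mul_of_nonneg_left h2 hs.1
    calc 2 * ε * dist w y ^ 2 = (1 - s) * (2 * ε * (inner ℝ (w - y) (a - y) : ℝ)) +
          s * (2 * ε * inner ℝ (w - y) (b - y)) := by rw [← h5]; ring
      _ ≤ (1 - s) * (dist w y * dist a y ^ 2) + s * (dist w y * dist b y ^ 2) := add_le_add h7 h8
      _ = _ := by rw [h4]; ring
  have h9 : dist z w ^ 2 ≤ (ε - dist w y) ^ 2 := by
    rcases (dist_nonneg (x := w) (y := y)).eq_or_lt with h10 | h10
    · rw [← h10, h3]
      have := mul_nonneg (mul_nonneg hs.1 (sub_nonneg.2 hs.2)) (sq_nonneg (dist a b))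
      nlinarith
    · have h11 : 2 * ε * dist w y ≤ dist w y ^ 2 + s * (1 - s) * dist a b ^ 2 := by
        refine le_of_mul_le_mul_left ?_ h10
        linarith
      rw [h3]
      linarith
  exact (sq_le_sq₀ dist_nonneg (by linarith)).1 h9

theorem dist_center_nearest_le {a b w z : Plane} (ha : a ∈ M) (hb : b ∈ M) (hab : dist a b < 2 * ε)
    (hw : w ∈ segment ℝ a b) (hza : dist z a = ε) (hzb : dist z b = ε) :
    dist z (nearest M w) ≤ ε := by
  linarith [h.dist_center_le ha hb hab hw hza hzb, dist_triangle z w (nearest M w)]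

/-- If the disc of radius `ε` about `z` through `p` and `q` contains no point of `S`, and no point
of `S` lies on the short arc of its boundary between `p` and `q`, then the reflected disc contains
no point of `S` either. -/
theorem le_dist_reflected_center {S : Set Plane} (hS : S ⊆ M) {p q z : Plane} (hp : p ∈ S)
    (hq : q ∈ S) (hne : p ≠ q) (hpq : dist p q < 2 * ε) (hzp : dist z p = ε) (hzq : dist z q = ε)
    (hz : ∀ s ∈ S, ε ≤ dist z s) (hbet : ∀ r ∈ S, dist z r = ε → ε ≤ dist (p + q - z) r) :
    ∀ s ∈ S, ε ≤ dist (p + q - z) s := by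
  intro s hs
  by_contra! hlt
  have hε := h.pos
  set z' := p + q - z with hz'
  have hz'p : dist z' p = ε := by
    rw [← hzq, hz', dist_eq_norm, dist_comm, dist_eq_norm]; congr 1; abel
  have hz'q : dist z' q = ε := by
    rw [← hzp, hz', dist_eq_norm, dist_comm, dist_eq_norm]; congr 1; abel
  have hzs : ε < dist z s :=
    lt_of_le_of_ne (hz s hs) fun he => absurd (hbet s hs he.symm) (not_le.2 hlt)
  have hzz : 0 < dist z z' ^ 2 := by
    have h1 : dist z z' ^ 2 = 4 * ε ^ 2 - dist p q ^ 2 := by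
      have e1 : dist z p ^ 2 = ε ^ 2 := by rw [hzp]
      have e2 : dist z q ^ 2 = ε ^ 2 := by rw [hzq]
      rw [plane_dist_sq] at e1 e2 ⊢
      rw [plane_dist_sq, hz']
      simp only [PiLp.sub_apply, PiLp.add_apply]
      linear_combination 2 * e1 + 2 * e2
    rw [h1]
    nlinarith [dist_nonneg (x := p) (y := q)]
  have h0 : 0 < dist z s ^ 2 - ε ^ 2 := by nlinarith
  have h1 : 0 < ε ^ 2 - dist z' s ^ 2 := by nlinarith [dist_nonneg (x := z') (y := s)]
  -- Slide the centre from `z` to `z'` through circles containing `p` and `q`. The power of `s` is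
  -- affine along the way, equal to `f0 > 0` at `z` and `-f1 < 0` at `z'`; at `μ` it vanishes, so
  -- `s` is on the circle about `c`, whose radius is less than `ε`.
  set f0 := dist z s ^ 2 - ε ^ 2
  set f1 := ε ^ 2 - dist z' s ^ 2
  set μ := f0 / (f0 + f1) with hμ
  have hμ0 : 0 < μ := by positivity
  have hμ1 : 0 < 1 - μ := by
    have : 1 - μ = f1 / (f0 + f1) := by rw [hμ]; field_simp; ring
    rw [this]; positivity
  have hμf : (1 - μ) * f0 - μ * f1 = 0 := by rw [hμ]; field_simp; ring
  set c : Plane := AffineMap.lineMap z z' μ with hc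
  have hcs := dist_lineMap_sq s z z' μ
  have hcp := dist_lineMap_sq p z z' μ
  have hcq := dist_lineMap_sq q z z' μ
  rw [dist_comm p z, dist_comm p z', hzp, hz'p] at hcp
  rw [dist_comm q z, dist_comm q z', hzq, hz'q] at hcq
  rw [dist_comm s z, dist_comm s z'] at hcs
  have e1 : dist c q = dist c p := by
    rw [dist_comm, dist_comm c]
    exact (sq_eq_sq₀ dist_nonneg dist_nonneg).1 (hcq.trans hcp.symm)
  have e2 : dist c s = dist c p := by
    rw [dist_comm, dist_comm c]
    refine (sq_eq_sq₀ dist_nonneg dist_nonneg).1 (hcs.trans ?_)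
    rw [hcp]
    linear_combination hμf
  have e3 : dist c p < ε := by
    rw [dist_comm]
    refine lt_of_pow_lt_pow_left₀ 2 hε.le ?_
    rw [hcp]
    have := mul_pos (mul_pos hμ0 hμ1) hzz
    linarith
  have hsp : s ≠ p := by rintro rfl; exact absurd hz'p hlt.ne
  have hsq : s ≠ q := by rintro rfl; exact absurd hz'q hlt.ne
  have hfar : ∀ y ∈ projectedArc M p q, dist s y < 2 * ε := by
    rintro _ ⟨w, hw, rfl⟩
    have := h.dist_center_nearest_le (hS hp) (hS hq) hpq hw hz'p hz'q
    linarith [dist_triangle_left s (nearest M w) z']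
  rcases h.exists_between (hS hp) (hS hq) (hS hs) hpq hne hsp hsq hfar with hb | hb | hb
  · exact absurd (h.tangent_mul_tangent_nonneg (hS hq) (hS hp) (hS hs) e1 e2 e3) (not_le.2 hb)
  · exact absurd (h.tangent_mul_tangent_nonneg (hS hp) (hS hq) (hS hs) e1.symm (e2.trans e1.symm)
      (e1 ▸ e3)) (not_le.2 hb)
  · exact absurd (h.tangent_mul_tangent_nonneg (hS hp) (hS hs) (hS hq) e2.symm (e1.trans e2.symm)
      (e2 ▸ e3)) (not_le.2 hb)

end HasTangentReach

/-! ### Edges, empty discs and the points that block them. -/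

/-- Two points of `S` at distance less than `2 * ε` span an edge if the open discs of radius `ε`
with both points on their boundary contain no point of `S`. -/
structure IsEdge (S : Set Plane) (ε : ℝ) (p q : Plane) : Prop where
  left_mem : p ∈ S
  right_mem : q ∈ S
  ne : p ≠ q
  dist_lt : dist p q < 2 * ε
  le_dist : ∀ z, dist z p = ε → dist z q = ε → ∀ s ∈ S, ε ≤ dist z s

theorem mem_compl_ballUnion {S : Set Plane} {ε : ℝ} {z : Plane} :
    z ∈ (ballUnion S ε)ᶜ ↔ ∀ s ∈ S, ε ≤ dist z s := by
  simp [ballUnion]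

theorem mem_ballUnion {S : Set Plane} {ε : ℝ} {z : Plane} :
    z ∈ ballUnion S ε ↔ ∃ s ∈ S, dist z s < ε := by
  simp [ballUnion]

theorem exists_center {p q : Plane} {ε : ℝ} (hne : p ≠ q) (hpq : dist p q < 2 * ε) :
    ∃ z, dist z p = ε ∧ dist z q = ε := by
  have hd : 0 < dist p q := dist_pos.2 hne
  have hε : 0 < ε := by linarith
  have hd2 := plane_dist_sq p q
  have hk : 0 ≤ ε ^ 2 / dist p q ^ 2 - 1 / 4 := by
    rw [sub_nonneg, div_le_div_iff₀ (by norm_num) (by positivity)]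
    nlinarith
  set k := Real.sqrt (ε ^ 2 / dist p q ^ 2 - 1 / 4) with hkdef
  have hk2 : k ^ 2 * dist p q ^ 2 + dist p q ^ 2 / 4 = ε ^ 2 := by
    rw [hkdef, Real.sq_sqrt hk]; field_simp; ring
  rw [hd2] at hk2
  refine ⟨p + (1 / 2 : ℝ) • (q - p) + k • quarterTurn (q - p), ?_, ?_⟩ <;>
  · refine (sq_eq_sq₀ dist_nonneg hε.le).1 ?_
    rw [plane_dist_sq, ← hk2]
    simp only [PiLp.add_apply, PiLp.smul_apply, PiLp.sub_apply, smul_eq_mul, quarterTurn_zero,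
      quarterTurn_one]
    ring

theorem dist_reflected_center_left {p q z : Plane} : dist (p + q - z) p = dist z q := by
  rw [dist_eq_norm, dist_comm, dist_eq_norm]; congr 1; abel

theorem dist_reflected_center_right {p q z : Plane} : dist (p + q - z) q = dist z p := by
  rw [dist_eq_norm, dist_comm, dist_eq_norm]; congr 1; abel

theorem reflected_center_ne {p q z : Plane} {ε : ℝ} (hpq : dist p q < 2 * ε)
    (hzp : dist z p = ε) : p + q - z ≠ z := by
  intro he
  have h1 : q - p = (2 : ℝ) • (z - p) :=
    calc q - p = (p + q - z) + z - (2 : ℝ) • p := by module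
      _ = (2 : ℝ) • (z - p) := by rw [he]; module
  refine hpq.ne ?_
  rw [dist_comm, dist_eq_norm, h1, norm_smul, ← dist_eq_norm, hzp]
  norm_num

theorem IsEdge.of_reflected {S : Set Plane} {ε : ℝ} {p q z : Plane} (hp : p ∈ S) (hq : q ∈ S)
    (hne : p ≠ q) (hpq : dist p q < 2 * ε) (hzp : dist z p = ε) (hzq : dist z q = ε)
    (hz : ∀ s ∈ S, ε ≤ dist z s) (hz' : ∀ s ∈ S, ε ≤ dist (p + q - z) s) : IsEdge S ε p q := by
  refine ⟨hp, hq, hne, hpq, fun c hcp hcq => ?_⟩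
  have := EuclideanGeometry.eq_of_dist_eq_of_dist_eq_of_finrank_eq_two (V := Plane) (by simp)
    hne (reflected_center_ne hpq hzp)
    (dist_reflected_center_left.trans hzq) hzp hcp (dist_reflected_center_right.trans hzp) hzq hcq
  rcases this with rfl | rfl
  exacts [hz', hz]

/-- On the circle of radius `ε` about `z`, a point closer than `ε` to the reflection of `z` in the
chord from `p` to `q` lies on the short arc between `p` and `q`. -/
theorem lt_of_dist_reflected_center_lt {p q r z : Plane} {ε : ℝ} (hzp : dist z p = ε)
    (hzq : dist z q = ε) (hzr : dist z r = ε) (hr : dist (p + q - z) r < ε) :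
    dist r p < dist q p ∧
    0 < (inner ℝ (q - p) (quarterTurn (z - p)) * inner ℝ (r - p) (quarterTurn (z - p)) : ℝ) := by
  have hε : 0 < ε := dist_nonneg.trans_lt hr
  have hP : dist z p ^ 2 = ε ^ 2 := by rw [hzp]
  have hQ : dist z q ^ 2 = ε ^ 2 := by rw [hzq]
  have hR : dist z r ^ 2 = ε ^ 2 := by rw [hzr]
  have hlt : dist (p + q - z) r ^ 2 < ε ^ 2 := by gcongr
  rw [plane_dist_sq] at hP hQ hR hlt
  simp only [PiLp.add_apply, PiLp.sub_apply] at hlt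
  -- These are the scalar products of the three radius vectors. Expanding the hypothesis on the
  -- reflected centre gives `ε ^ 2 + c < a + b`, and the rest is algebra in `a`, `b`, `c`.
  set a := (z 0 - r 0) * (z 0 - p 0) + (z 1 - r 1) * (z 1 - p 1) with ha
  set b := (z 0 - r 0) * (z 0 - q 0) + (z 1 - r 1) * (z 1 - q 1) with hb
  set c := (z 0 - p 0) * (z 0 - q 0) + (z 1 - p 1) * (z 1 - q 1) with hc
  have h1 : ε ^ 2 + c < a + b := by
    rw [ha, hb, hc]; linarith
  have hbε : b ≤ ε ^ 2 := by
    rw [hb]; linarith [sq_nonneg (q 0 - r 0), sq_nonneg (q 1 - r 1)]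
  have haε : a ≤ ε ^ 2 := by
    rw [ha]; linarith [sq_nonneg (p 0 - r 0), sq_nonneg (p 1 - r 1)]
  have hcε : 0 ≤ ε ^ 2 + c := by
    rw [hc]; linarith [sq_nonneg (2 * z 0 - p 0 - q 0), sq_nonneg (2 * z 1 - p 1 - q 1)]
  have hprod : (inner ℝ (q - p) (quarterTurn (z - p)) * inner ℝ (r - p) (quarterTurn (z - p)) : ℝ) =
      ε ^ 2 * b - a * c := by
    rw [plane_inner, plane_inner, ha, hb, hc, ← hP]
    simp only [PiLp.sub_apply, quarterTurn_zero, quarterTurn_one]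
    ring
  refine ⟨lt_of_pow_lt_pow_left₀ 2 dist_nonneg ?_, ?_⟩
  · rw [plane_dist_sq, plane_dist_sq]
    have h2 : c < a := by linarith
    rw [ha, hc] at h2
    linarith
  · rw [hprod]
    by_contra! hle
    have h2 : 0 < ε ^ 2 := by positivity
    have h3 := mul_lt_mul_of_pos_left h1 h2
    have h4 := mul_le_mul_of_nonneg_right haε hcε
    linarith

/-- For samples on the circle the squared distance has a nonnegative linear and a nonnegative
quadratic term in `t`; the others stay away by continuity. -/
theorem eventually_push {S : Set Plane} (hS : S.Finite) {ε : ℝ} {z d : Plane}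
    (hz : ∀ s ∈ S, ε ≤ dist z s) (hd : ∀ r ∈ S, dist z r = ε → inner ℝ d (r - z) ≤ (0 : ℝ)) :
    ∀ᶠ t in 𝓝[>] (0 : ℝ), ∀ s ∈ S, ε ≤ dist (z + t • d) s := by
  refine (Filter.eventually_all_finite hS).2 fun s hs => ?_
  rcases (hz s hs).eq_or_lt with he | hlt
  · filter_upwards [self_mem_nhdsWithin] with t (ht : 0 < t)
    have h1 := hd s hs he.symm
    rw [he]
    refine (sq_le_sq₀ dist_nonneg dist_nonneg).1 ?_
    rw [plane_inner] at h1
    rw [plane_dist_sq, plane_dist_sq]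
    simp only [PiLp.add_apply, PiLp.smul_apply, PiLp.sub_apply, smul_eq_mul] at h1 ⊢
    have h2 := mul_nonneg ht.le (neg_nonneg.2 h1)
    nlinarith [sq_nonneg (t * d 0), sq_nonneg (t * d 1)]
  · have hc : Tendsto (fun t : ℝ => dist (z + t • d) s) (𝓝[>] 0) (𝓝 (dist (z + (0 : ℝ) • d) s)) :=
      ((by fun_prop : Continuous fun t : ℝ => dist (z + t • d) s).tendsto 0).mono_left
        nhdsWithin_le_nhds
    rw [zero_smul, add_zero] at hc
    filter_upwards [hc.eventually (lt_mem_nhds hlt)] with t ht using ht.le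

/-- With no such sample, `z` could be pushed along `d` inside the complement and would come closer
to `x`. -/
theorem exists_blocking {S : Set Plane} (hS : S.Finite) {ε : ℝ} {x z d : Plane}
    (hz : z ∈ closestPoints (ballUnion S ε)ᶜ x) (hd : 0 < (inner ℝ d (x - z) : ℝ)) :
    ∃ r ∈ S, dist z r = ε ∧ 0 < (inner ℝ d (r - z) : ℝ) := by
  by_contra! hno
  have h1 := eventually_push hS (mem_compl_ballUnion.1 hz.1) hno
  have h2 : ∀ᶠ t in 𝓝[>] (0 : ℝ), t * ‖d‖ ^ 2 < 2 * inner ℝ d (x - z) := by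
    have hc : Tendsto (fun t : ℝ => t * ‖d‖ ^ 2) (𝓝[>] 0) (𝓝 (0 * ‖d‖ ^ 2)) :=
      ((by fun_prop : Continuous fun t : ℝ => t * ‖d‖ ^ 2).tendsto 0).mono_left nhdsWithin_le_nhds
    rw [zero_mul] at hc
    exact hc.eventually (gt_mem_nhds (by linarith))
  obtain ⟨t, ht1, ht2, ht⟩ := (h1.and (h2.and self_mem_nhdsWithin)).exists
  replace ht : 0 < t := ht
  have h3 := hz.2 _ (mem_compl_ballUnion.2 ht1)
  have h4 : dist x z ^ 2 ≤ dist x (z + t • d) ^ 2 := by gcongr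
  rw [plane_dist_sq, plane_dist_sq] at h4
  rw [plane_norm_sq, plane_inner] at ht2
  simp only [PiLp.add_apply, PiLp.smul_apply, PiLp.sub_apply, smul_eq_mul] at h4 ht2
  nlinarith

namespace HasTangentReach

variable {M : Set Plane} {ε : ℝ} {T : Plane → Plane} (h : HasTangentReach M ε T)
include h

theorem le_dist_pole {y a u : Plane} (hy : y ∈ M) (ha : a ∈ M) (hu : inner ℝ u (T y) = 0)
    (hu1 : ‖u‖ = 1) : ε ≤ dist (y + ε • u) a := by
  have h1 := h.inner_normal_le hy ha hu
  refine (sq_le_sq₀ h.pos.le dist_nonneg).1 ?_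
  have h2 : ‖u‖ ^ 2 = 1 := by rw [hu1, one_pow]
  rw [hu1, one_mul, plane_norm_sq, plane_inner] at h1
  rw [plane_norm_sq] at h2
  rw [plane_dist_sq]
  simp only [PiLp.add_apply, PiLp.smul_apply, PiLp.sub_apply, smul_eq_mul] at h1 ⊢
  linear_combination h1 - ε ^ 2 * h2

/-- Suppose the projection `y` of `w` is a sample. Both centres `c` of the edge satisfy `dist c y ≥
ε` and `dist c w ≤ ε - dist w y`. If `w ≠ y`, equality in the triangle inequality places both on the
ray from `y` through `w` at the same distance, but they are distinct. If `w = y`, then `w` is a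
sample on the chord, and emptiness of the discs leaves only the endpoints. -/
theorem mem_endpoints_of_nearest_mem {S : Set Plane} (hS : S ⊆ M) {p q w : Plane}
    (he : IsEdge S ε p q) (hw : w ∈ segment ℝ p q) (hy : nearest M w ∈ S) : w = p ∨ w = q := by
  have hε := h.pos
  obtain ⟨z, hzp, hzq⟩ := exists_center he.ne he.dist_lt
  have hz'p : dist (p + q - z) p = ε := dist_reflected_center_left.trans hzq
  have hz'q : dist (p + q - z) q = ε := dist_reflected_center_right.trans hzp
  have h1 := he.le_dist z hzp hzq _ hy
  have hp := hS he.left_mem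
  have hq := hS he.right_mem
  have h2 := h.dist_center_le hp hq he.dist_lt hw hzp hzq
  rcases (dist_nonneg (x := w) (y := nearest M w)).eq_or_lt with h0 | h0
  · rw [← dist_eq_zero.1 h0.symm] at h1
    obtain ⟨s, hs, rfl⟩ := mem_segment_iff_lineMap.1 hw
    have h3 := dist_lineMap_sq z p q s
    rw [hzp, hzq] at h3
    have h4 : s * (1 - s) * dist p q ^ 2 ≤ 0 := by
      have : ε ^ 2 ≤ dist z (AffineMap.lineMap p q s) ^ 2 := by gcongr
      linarith
    have h5 : 0 < dist p q ^ 2 := pow_pos (dist_pos.2 he.ne) 2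
    have h6 : s * (1 - s) ≤ 0 := nonpos_of_mul_nonpos_left h4 h5
    have h7 : s * (1 - s) = 0 := le_antisymm h6 (mul_nonneg hs.1 (sub_nonneg.2 hs.2))
    rcases mul_eq_zero.1 h7 with h8 | h8
    · left; rw [h8, AffineMap.lineMap_apply_zero]
    · right; rw [← sub_eq_zero.1 h8, AffineMap.lineMap_apply_one]
  · exfalso
    have key : ∀ c, dist c p = ε → dist c q = ε →
        c - w = ((ε - dist w (nearest M w)) / dist w (nearest M w)) • (w - nearest M w) := by
      intro c hcp hcq
      have h3 := he.le_dist c hcp hcq _ hy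
      have h4 := h.dist_center_le hp hq he.dist_lt hw hcp hcq
      set y := nearest M w
      set t := dist w y with ht
      have h5 : dist c w ^ 2 ≤ (ε - t) ^ 2 := by gcongr
      have h6 : ε ^ 2 ≤ dist c y ^ 2 := by gcongr
      have h7 : dist c y ^ 2 = dist c w ^ 2 + 2 * inner ℝ (c - w) (w - y) + t ^ 2 := by
        rw [ht, plane_dist_sq, plane_dist_sq, plane_dist_sq, plane_inner]
        simp only [PiLp.sub_apply]; ring
      have h8 : (ε - t) * t ≤ inner ℝ (c - w) (w - y) := by linarith
      have ht0 : 0 ≤ ε - t := dist_nonneg.trans h4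
      set k := (ε - t) / t with hk
      have hk0 : 0 ≤ k := div_nonneg ht0 h0.le
      have hkt : k * t = ε - t := div_mul_cancel₀ _ h0.ne'
      have h9 : ‖(c - w) - k • (w - y)‖ ^ 2 ≤ 0 := by
        have e : ‖(c - w) - k • (w - y)‖ ^ 2 =
            dist c w ^ 2 - 2 * k * inner ℝ (c - w) (w - y) + k ^ 2 * t ^ 2 := by
          rw [ht, plane_dist_sq, plane_dist_sq, plane_norm_sq, plane_inner]
          simp only [PiLp.sub_apply, PiLp.smul_apply, smul_eq_mul]; ring
        have h10 := mul_le_mul_of_nonneg_left h8 hk0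
        rw [e]
        nlinarith
      exact sub_eq_zero.1 (norm_eq_zero.1 (pow_eq_zero_iff two_ne_zero |>.1
        (le_antisymm h9 (sq_nonneg _))))
    have h3 := (key z hzp hzq).trans (key _ hz'p hz'q).symm
    exact reflected_center_ne he.dist_lt hzp (sub_left_injective h3).symm

theorem subset_medialAxis {S : Set Plane} (hS : S ⊆ M) : S ⊆ medialAxis (ballUnion S ε) := by
  intro s hs
  have hε := h.pos
  have h1 := h.norm_tangent s (hS hs)
  have key : ∀ u : Plane, inner ℝ u (T s) = 0 → ‖u‖ = 1 →
      s + ε • u ∈ closestPoints (ballUnion S ε)ᶜ s := by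
    intro u hu hu1
    refine ⟨mem_compl_ballUnion.2 fun a ha => h.le_dist_pole (hS hs) (hS ha) hu hu1, fun z hz => ?_⟩
    rw [dist_comm s z]
    refine le_trans ?_ (mem_compl_ballUnion.1 hz s hs)
    rw [dist_self_add_right, norm_smul, hu1, mul_one, Real.norm_eq_abs, abs_of_pos hε]
  have hn : ‖quarterTurn (T s)‖ = 1 := by rw [norm_quarterTurn, h1]
  have h0 : inner ℝ (quarterTurn (T s)) (T s) = 0 := by
    rw [real_inner_comm]; exact inner_quarterTurn_self _
  refine ⟨mem_ballUnion.2 ⟨s, hs, by simpa using hε⟩, _, key _ h0 hn, _,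
    key (-quarterTurn (T s)) (by rw [inner_neg_left, h0, neg_zero]) (by rw [norm_neg, hn]), ?_⟩
  intro he
  have h2 := smul_right_injective Plane hε.ne' (add_left_cancel he)
  have h3 : (2 : ℝ) • quarterTurn (T s) = 0 := by
    rw [two_smul]; nth_rewrite 1 [h2]; abel
  replace h3 := (smul_eq_zero.1 h3).resolve_left two_ne_zero
  rw [h3, norm_zero] at hn
  exact zero_ne_one hn

/-- On the segment, the squared distance to `w` is a weighted mean of those from `w` to `p` and `q`,
minus a term independent of `w`. The complement bounds both by `ε ^ 2` from below, and both centres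
attain the bound. -/
theorem segment_subset_medialAxis {S : Set Plane} {p q : Plane}
    (he : IsEdge S ε p q) : segment ℝ p q ⊆ medialAxis (ballUnion S ε) := by
  intro x hx
  obtain ⟨z, hzp, hzq⟩ := exists_center he.ne he.dist_lt
  have key : ∀ c, dist c p = ε → dist c q = ε → c ∈ closestPoints (ballUnion S ε)ᶜ x := by
    intro c hcp hcq
    refine ⟨mem_compl_ballUnion.2 (he.le_dist c hcp hcq), fun w hw => ?_⟩
    rw [mem_compl_ballUnion] at hw
    obtain ⟨s, hs, rfl⟩ := mem_segment_iff_lineMap.1 hx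
    rw [dist_comm _ c, dist_comm _ w]
    refine (sq_le_sq₀ dist_nonneg dist_nonneg).1 ?_
    rw [dist_lineMap_sq, dist_lineMap_sq, hcp, hcq]
    have := sub_nonneg.2 hs.2
    have := hs.1
    have := hw p he.left_mem
    have := hw q he.right_mem
    have := h.pos
    gcongr
  refine ⟨mem_ballUnion.2 ?_, _, key _ hzp hzq, _,
    key (p + q - z) (dist_reflected_center_left.trans hzq) (dist_reflected_center_right.trans hzp),
    (reflected_center_ne he.dist_lt hzp).symm⟩
  have h1 := dist_add_dist_of_mem_segment' hx
  have h2 := he.dist_lt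
  rcases le_total (dist x p) (dist x q) with hle | hle
  · exact ⟨p, he.left_mem, by linarith⟩
  · exact ⟨q, he.right_mem, by linarith⟩

/-- Going from the projection `m` of `x` through `x` to distance `ε` from `m` ends at the centre of
a tangent disc, which is in the complement. -/
theorem dist_closestPoints_compl_le {S : Set Plane} (hS : S ⊆ M) {x z : Plane}
    (hx : x ∈ ballUnion S ε) (hz : z ∈ closestPoints (ballUnion S ε)ᶜ x) : dist x z ≤ ε := by
  have hε := h.pos
  obtain ⟨s, hs, hxs⟩ := mem_ballUnion.1 hx
  have hm := h.nearest_mem (x := x) (hS hs)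
  have h0 := h.inner_sub_nearest (x := x) (hS hs)
  have hd := (h.dist_nearest_le (x := x) (hS hs)).trans_lt hxs
  set m := nearest M x
  obtain ⟨u, hu0, hu1, hu⟩ : ∃ u : Plane, inner ℝ u (T m) = 0 ∧ ‖u‖ = 1 ∧ x - m = dist x m • u := by
    rcases eq_or_ne x m with he | he
    · refine ⟨quarterTurn (T m), ?_, ?_, ?_⟩
      · rw [real_inner_comm]; exact inner_quarterTurn_self _
      · rw [norm_quarterTurn, h.norm_tangent m hm]
      · rw [← he, sub_self, dist_self, zero_smul]
    · have hne := norm_ne_zero_iff.2 (sub_ne_zero.2 he)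
      refine ⟨‖x - m‖⁻¹ • (x - m), ?_, ?_, ?_⟩
      · rw [inner_smul_left, h0, mul_zero]
      · rw [norm_smul, norm_inv, norm_norm, inv_mul_cancel₀ hne]
      · rw [dist_eq_norm, smul_smul, mul_inv_cancel₀ hne, one_smul]
  refine (hz.2 (m + ε • u) (mem_compl_ballUnion.2 fun a ha =>
    h.le_dist_pole hm (hS ha) hu0 hu1)).trans ?_
  have h2 : x - (m + ε • u) = (dist x m - ε) • u := by
    rw [← sub_sub, hu, sub_smul]
  rw [dist_eq_norm, h2, norm_smul, hu1, mul_one, Real.norm_eq_abs, abs_of_neg (by linarith)]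
  linarith [dist_nonneg (x := x) (y := m)]

end HasTangentReach

/-! ### The medial axis is the edge polygon. -/

/-- The polygon spanned by the points of `S` and the edges between them. -/
def edgePolygon (S : Set Plane) (ε : ℝ) : Set Plane :=
  S ∪ {x | ∃ p q, IsEdge S ε p q ∧ x ∈ segment ℝ p q}

theorem dist_barycentric_sq_sub (w z p q : Plane) (α β : ℝ) :
    dist w (p + α • (z - p) + β • (q - p)) ^ 2 - dist z (p + α • (z - p) + β • (q - p)) ^ 2 =
      (1 - α - β) * (dist w p ^ 2 - dist z p ^ 2) + β * (dist w q ^ 2 - dist z q ^ 2) +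
      α * dist w z ^ 2 := by
  simp only [plane_dist_sq, PiLp.add_apply, PiLp.smul_apply, PiLp.sub_apply, smul_eq_mul]
  ring

theorem exists_eq_add_smul_of_inner_ne_zero {V E X : Plane}
    (hE : (inner ℝ E (quarterTurn V) : ℝ) ≠ 0) :
    ∃ α : ℝ, X = α • V + (inner ℝ X (quarterTurn V) / inner ℝ E (quarterTurn V) : ℝ) • E := by
  set β : ℝ := inner ℝ X (quarterTurn V) / inner ℝ E (quarterTurn V)
  have h1 : inner ℝ (X - β • E) (quarterTurn V) = 0 := by
    rw [inner_sub_left, inner_smul_left]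
    simp only [conj_trivial, β]
    rw [div_mul_cancel₀ _ hE, sub_self]
  have h2 := smul_eq_of_inner_quarterTurn_eq_zero h1
  have hV : ‖V‖ ^ 2 ≠ 0 := by
    refine pow_ne_zero 2 (norm_ne_zero_iff.2 ?_)
    rintro rfl
    apply hE
    rw [plane_inner]; simp
  refine ⟨inner ℝ (X - β • E) V / ‖V‖ ^ 2, ?_⟩
  rw [div_eq_inv_mul, mul_smul, ← h2, smul_smul, inv_mul_cancel₀ hV, one_smul, sub_add_cancel]

/-- If `x` is in the triangle `z`, `p`, `q` with weight `α > 0` at `z`, then `dist x w ^ 2 - dist x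
z ^ 2 ≥ α * dist w z ^ 2` for every `w` in the complement, so `z` is the only closest point. -/
theorem eq_of_mem_closestPoints_of_barycentric {S : Set Plane} {ε : ℝ} {x z w p q : Plane}
    {α β : ℝ} (hε : 0 < ε)
    (hz : z ∈ closestPoints (ballUnion S ε)ᶜ x) (hw : w ∈ closestPoints (ballUnion S ε)ᶜ x)
    (hp : p ∈ S) (hq : q ∈ S) (hzp : dist z p = ε) (hzq : dist z q = ε)
    (hx : x = p + α • (z - p) + β • (q - p)) (hα : 0 < α) (hβ : 0 ≤ β) (hαβ : α + β ≤ 1) :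
    w = z := by
  have h1 : dist x w ≤ dist x z := hw.2 z hz.1
  have h2 := mem_compl_ballUnion.1 hw.1
  have h3 := dist_barycentric_sq_sub w z p q α β
  rw [← hx, hzp, hzq, dist_comm w x, dist_comm z x] at h3
  have h4 : dist x w ^ 2 ≤ dist x z ^ 2 := by gcongr
  have h5 : ε ^ 2 ≤ dist w p ^ 2 := by have := h2 p hp; gcongr
  have h6 : ε ^ 2 ≤ dist w q ^ 2 := by have := h2 q hq; gcongr
  have h7 := mul_nonneg (show 0 ≤ 1 - α - β by linarith) (sub_nonneg.2 h5)
  have h8 := mul_nonneg hβ (sub_nonneg.2 h6)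
  have h9 : α * dist w z ^ 2 ≤ 0 := by linarith
  exact dist_eq_zero.1 (pow_eq_zero_iff two_ne_zero |>.1
    (le_antisymm (nonpos_of_mul_nonpos_right h9 hα) (sq_nonneg _)))

theorem dist_lt_of_inner_ne_zero {z p q : Plane} {ε : ℝ} (hε : 0 < ε) (hzp : dist z p = ε)
    (hzq : dist z q = ε) (h0 : (inner ℝ (q - p) (quarterTurn (z - p)) : ℝ) ≠ 0) :
    dist p q < 2 * ε := by
  refine lt_of_pow_lt_pow_left₀ 2 (by linarith) ?_
  have e1 : dist z p ^ 2 = ε ^ 2 := by rw [hzp]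
  have e2 : dist z q ^ 2 = ε ^ 2 := by rw [hzq]
  have h1 : 0 < (inner ℝ (q - p) (quarterTurn (z - p)) : ℝ) ^ 2 := by positivity
  rw [plane_dist_sq] at e1 e2 ⊢
  rw [plane_inner] at h1
  simp only [PiLp.sub_apply, quarterTurn_zero, quarterTurn_one] at h1
  set P0 := z 0 - p 0 with hP0
  set P1 := z 1 - p 1 with hP1
  set Q0 := z 0 - q 0 with hQ0
  set Q1 := z 1 - q 1 with hQ1
  rw [show p 0 - q 0 = Q0 - P0 by rw [hP0, hQ0]; ring,
    show p 1 - q 1 = Q1 - P1 by rw [hP1, hQ1]; ring]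
  rw [show q 0 - p 0 = P0 - Q0 by rw [hP0, hQ0]; ring,
    show q 1 - p 1 = P1 - Q1 by rw [hP1, hQ1]; ring] at h1
  have h2 : (P0 * Q0 + P1 * Q1) ^ 2 < (ε ^ 2) ^ 2 := by
    have e3 : (P0 * Q0 + P1 * Q1) ^ 2 + ((P0 - Q0) * -P1 + (P1 - Q1) * P0) ^ 2 =
        ε ^ 2 * ε ^ 2 := by
      rw [← e1]; nth_rewrite 2 [e1]; rw [← e2]; ring
    nlinarith
  have h3 := abs_lt.1 (abs_lt_of_sq_lt_sq h2 (by positivity))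
  nlinarith [h3.1]

namespace HasTangentReach

variable {M : Set Plane} {ε : ℝ} {T : Plane → Plane} (h : HasTangentReach M ε T)
include h

/-- Among the points of `S` on the circle about `z` on a given side of the diameter through `p`,
the one nearest to `p` spans an edge with `p`. -/
theorem exists_isEdge_of_side {S : Set Plane} (hS : S ⊆ M) (hSfin : S.Finite) {z p r : Plane}
    {D : ℝ} (hz : ∀ s ∈ S, ε ≤ dist z s) (hp : p ∈ S) (hzp : dist z p = ε) (hr : r ∈ S)
    (hzr : dist z r = ε) (hD : 0 < D * inner ℝ (r - p) (quarterTurn (z - p))) :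
    ∃ q, IsEdge S ε p q ∧ dist z q = ε ∧ 0 < D * inner ℝ (q - p) (quarterTurn (z - p)) := by
  obtain ⟨q, ⟨hq, hzq, hDq⟩, hmin⟩ := Set.exists_min_image
    {q | q ∈ S ∧ dist z q = ε ∧ 0 < D * inner ℝ (q - p) (quarterTurn (z - p))}
    (fun q => dist q p) (hSfin.subset fun q hq => hq.1) ⟨r, hr, hzr, hD⟩
  have h0 : (inner ℝ (q - p) (quarterTurn (z - p)) : ℝ) ≠ 0 := by
    intro h0; rw [h0, mul_zero] at hDq; exact lt_irrefl _ hDq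
  have hne : p ≠ q := by
    rintro rfl; rw [sub_self, inner_zero_left] at h0; exact h0 rfl
  have hpq := dist_lt_of_inner_ne_zero h.pos hzp hzq h0
  refine ⟨q, IsEdge.of_reflected hp hq hne hpq hzp hzq hz
    (h.le_dist_reflected_center hS hp hq hne hpq hzp hzq hz fun s hs hzs => ?_), hzq, hDq⟩
  -- A sample on the short arc between `p` and `q` would be on the same side of the diameter and
  -- nearer to `p`.
  by_contra! hlt
  obtain ⟨h1, h2⟩ := lt_of_dist_reflected_center_lt hzp hzq hzs hlt
  refine absurd (hmin s ⟨hs, hzs, ?_⟩) (not_le.2 h1)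
  have h3 := mul_pos hDq h2
  have h4 : 0 < (inner ℝ (q - p) (quarterTurn (z - p)) : ℝ) ^ 2 := by positivity
  refine pos_of_mul_pos_left (b := (inner ℝ (q - p) (quarterTurn (z - p)) : ℝ) ^ 2) ?_ h4.le
  linarith

/-- Let `p` be the sample on the circle about `z` that is nearest to `x`. If `x` is off the line `z
p`, a blocking sample perpendicular to that line yields an edge `p q` on the side of `x`. In
coordinates `x = p + α • (z - p) + β • (q - p)` one finds `α ≥ 0`, `β > 0` and `α + 2 * β ≤ 1`. The
second closest point excludes `α > 0`, so `x` is on the edge. -/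
theorem medialAxis_subset_edgePolygon {S : Set Plane} (hS : S ⊆ M) (hSfin : S.Finite) :
    medialAxis (ballUnion S ε) ⊆ edgePolygon S ε := by
  rintro x ⟨hx, z, hz, w, hw, hzw⟩
  have hε := h.pos
  have hzc := mem_compl_ballUnion.1 hz.1
  have hxz : x ≠ z := by rintro rfl; exact hz.1 hx
  have hblock : ∀ d, 0 < (inner ℝ d (x - z) : ℝ) →
    ∃ r ∈ S, dist z r = ε ∧ 0 < (inner ℝ d (r - z) : ℝ) := fun d hd => exists_blocking hSfin hz hd
  have hxz2 : 0 < (inner ℝ (x - z) (x - z) : ℝ) := by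
    rw [real_inner_self_eq_norm_sq]
    exact pow_pos (norm_pos_iff.2 (sub_ne_zero.2 hxz)) 2
  obtain ⟨r₀, hr₀, hzr₀, -⟩ := hblock (x - z) hxz2
  obtain ⟨p, ⟨hp, hzp⟩, hmin⟩ := Set.exists_min_image {r | r ∈ S ∧ dist z r = ε}
    (fun r => dist x r) (hSfin.subset fun q hq => hq.1) ⟨r₀, hr₀, hzr₀⟩
  by_cases hxp : x = p
  · left; rwa [hxp]
  have hV : ‖z - p‖ ^ 2 = ε ^ 2 := by rw [← dist_eq_norm, hzp]
  by_cases hD : (inner ℝ (x - p) (quarterTurn (z - p)) : ℝ) = 0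
  · exfalso
    have h1 := smul_eq_of_inner_quarterTurn_eq_zero hD
    rw [hV] at h1
    set l : ℝ := inner ℝ (x - p) (z - p) / ε ^ 2 with hl
    have h2 : x - p = l • (z - p) := by
      rw [hl, div_eq_inv_mul, mul_smul, ← h1, smul_smul, inv_mul_cancel₀ (by positivity), one_smul]
    have h3 : x - z = (l - 1) • (z - p) := by
      rw [sub_smul, ← h2, one_smul]; abel
    have hzpn : ‖z - p‖ = ε := by rw [← dist_eq_norm, hzp]
    have hl0 : l ≠ 0 := by
      intro h0; rw [h0, zero_smul] at h2; exact hxp (sub_eq_zero.1 h2)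
    have hd : dist x z = |l - 1| * ε := by
      rw [dist_eq_norm, h3, norm_smul, hzpn, Real.norm_eq_abs]
    have hlpos : 0 < l := by
      by_contra! hle
      have h4 : l < 0 := lt_of_le_of_ne hle hl0
      have h5 := h.dist_closestPoints_compl_le hS hx hz
      rw [hd, abs_of_neg (by linarith)] at h5
      nlinarith
    -- Up to `z`, the point `x` has `z` as its only closest point. Beyond `z`, a sample blocking the
    -- direction `x - z` would be nearer to `x` than `p`.
    rcases le_or_gt l 1 with hl1 | hl1
    · refine hzw (eq_of_mem_closestPoints_of_barycentric (α := l) (β := 0) hε hz hw hp hp hzp hzp ?_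
        hlpos le_rfl (by linarith)).symm
      rw [zero_smul, add_zero, ← h2]; abel
    · obtain ⟨r, hr, hzr, hrpos⟩ := hblock (x - z) hxz2
      have h4 : dist x p ^ 2 ≤ dist x r ^ 2 := by
        have := hmin r ⟨hr, hzr⟩; gcongr
      have h5 : dist x r ^ 2 = dist x z ^ 2 + ε ^ 2 - 2 * inner ℝ (x - z) (r - z) := by
        rw [← hzr, plane_dist_sq, plane_dist_sq, plane_dist_sq, plane_inner]
        simp only [PiLp.sub_apply]; ring
      have h6 : dist x p = l * ε := by
        rw [dist_eq_norm, h2, norm_smul, hzpn, Real.norm_eq_abs, abs_of_pos hlpos]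
      rw [h5, h6, hd, abs_of_pos (by linarith)] at h4
      have h7 := mul_pos (sub_pos.2 hl1) (pow_pos hε 2)
      nlinarith
  · set D : ℝ := inner ℝ (x - p) (quarterTurn (z - p)) with hDdef
    have hperp : ∀ a : Plane, (inner ℝ (D • quarterTurn (z - p)) (a - z) : ℝ) =
        D * inner ℝ (a - p) (quarterTurn (z - p)) := by
      intro a
      rw [inner_smul_left, plane_inner, plane_inner]
      simp only [PiLp.sub_apply, quarterTurn_zero, quarterTurn_one, conj_trivial]; ring
    obtain ⟨r, hr, hzr, hrpos⟩ := hblock (D • quarterTurn (z - p)) (by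
      rw [hperp, ← hDdef]; exact mul_self_pos.2 hD)
    rw [hperp] at hrpos
    obtain ⟨q, he, hzq, hDq⟩ := h.exists_isEdge_of_side hS hSfin hzc hp hzp hr hzr hrpos
    have h0 : (inner ℝ (q - p) (quarterTurn (z - p)) : ℝ) ≠ 0 := by
      intro h0; rw [h0, mul_zero] at hDq; exact lt_irrefl _ hDq
    obtain ⟨α, hα⟩ := exists_eq_add_smul_of_inner_ne_zero (X := x - p) h0
    rw [← hDdef] at hα
    set β : ℝ := D / inner ℝ (q - p) (quarterTurn (z - p)) with hβdef
    have hβ : 0 < β := by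
      rcases mul_pos_iff.1 hDq with ⟨h1, h2⟩ | ⟨h1, h2⟩
      exacts [div_pos h1 h2, div_pos_of_neg_of_neg h1 h2]
    have hVE : 2 * (inner ℝ (z - p) (q - p) : ℝ) = ‖q - p‖ ^ 2 :=
      two_mul_inner_sub_eq_of_dist_eq (hzq.trans hzp.symm)
    have hXV : (inner ℝ (x - p) (z - p) : ℝ) = α * ε ^ 2 + β * (‖q - p‖ ^ 2 / 2) := by
      rw [hα, inner_add_left, inner_smul_left, inner_smul_left, real_inner_self_eq_norm_sq, hV,
        real_inner_comm, ← hVE]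
      simp only [conj_trivial]; ring
    have hXE : (inner ℝ (x - p) (q - p) : ℝ) = α * (‖q - p‖ ^ 2 / 2) + β * ‖q - p‖ ^ 2 := by
      rw [hα, inner_add_left, inner_smul_left, inner_smul_left, real_inner_self_eq_norm_sq, ← hVE]
      simp only [conj_trivial]; ring
    have he0 : 0 < ‖q - p‖ ^ 2 := pow_pos (norm_pos_iff.2 (sub_ne_zero.2 he.ne.symm)) 2
    have he1 : ‖q - p‖ ^ 2 < 4 * ε ^ 2 := by
      have := he.dist_lt
      rw [dist_comm, dist_eq_norm] at this
      nlinarith [norm_nonneg (q - p)]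
    -- The reflected centre is also in the complement, so it is no closer to `x` than `z` is.
    have hα0 : 0 ≤ α := by
      have h1 : dist x z ≤ dist x (p + q - z) := hz.2 _ (mem_compl_ballUnion.2
        (he.le_dist _ (dist_reflected_center_left.trans hzq)
          (dist_reflected_center_right.trans hzp)))
      have h2 : dist x z ^ 2 ≤ dist x (p + q - z) ^ 2 := by gcongr
      have h3 : dist x (p + q - z) ^ 2 - dist x z ^ 2 = 4 * inner ℝ (x - p) (z - p) -
          2 * inner ℝ (x - p) (q - p) + ‖q - p‖ ^ 2 - 2 * inner ℝ (z - p) (q - p) := by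
        rw [plane_dist_sq, plane_dist_sq, plane_inner, plane_inner, plane_inner, plane_norm_sq]
        simp only [PiLp.sub_apply, PiLp.add_apply]; ring
      rw [hVE, hXV, hXE] at h3
      have h4 : 0 ≤ α * (4 * ε ^ 2 - ‖q - p‖ ^ 2) := by linarith
      exact nonneg_of_mul_nonneg_left h4 (by linarith)
    have hαβ : α + 2 * β ≤ 1 := by
      have h1 : dist x p ^ 2 ≤ dist x q ^ 2 := by
        have := hmin q ⟨he.right_mem, hzq⟩; gcongr
      have h2 : dist x q ^ 2 - dist x p ^ 2 = ‖q - p‖ ^ 2 - 2 * inner ℝ (x - p) (q - p) := by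
        rw [plane_dist_sq, plane_dist_sq, plane_inner, plane_norm_sq]
        simp only [PiLp.sub_apply]; ring
      rw [hXE] at h2
      have h3 : 0 ≤ (1 - (α + 2 * β)) * ‖q - p‖ ^ 2 := by linarith
      linarith [nonneg_of_mul_nonneg_left h3 he0]
    have hx' : x = p + α • (z - p) + β • (q - p) := by
      rw [add_assoc, ← hα]; abel
    rcases hα0.eq_or_lt with h1 | h1
    · right
      refine ⟨p, q, he, mem_segment_iff_lineMap.2 ⟨β, ⟨hβ.le, by linarith⟩, ?_⟩⟩
      rw [hx', ← h1, zero_smul, add_zero, AffineMap.lineMap_apply_module', add_comm]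
    · exact absurd (eq_of_mem_closestPoints_of_barycentric hε hz hw hp he.right_mem hzp hzq hx' h1
        hβ.le (by linarith)).symm hzw

theorem medialAxis_eq_edgePolygon {S : Set Plane} (hS : S ⊆ M) (hSfin : S.Finite) :
    medialAxis (ballUnion S ε) = edgePolygon S ε := by
  refine (h.medialAxis_subset_edgePolygon hS hSfin).antisymm (Set.union_subset
    (h.subset_medialAxis hS) ?_)
  rintro x ⟨p, q, he, hx⟩
  exact h.segment_subset_medialAxis he hx

end HasTangentReach

/-! ### Openness of arcs and injectivity of the projection on the polygon. -/

theorem image_mem_nhds_of_injOn {f : ℝ → ℝ} {a b s : ℝ} (hs : s ∈ Set.Ioo a b)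
    (hc : ContinuousOn f (Set.Icc a b)) (hi : Set.InjOn f (Set.Icc a b)) :
    f '' Set.Icc a b ∈ 𝓝 (f s) := by
  have hab : a ≤ b := (hs.1.trans hs.2).le
  have hsI := Set.Ioo_subset_Icc_self hs
  rcases hc.strictMonoOn_of_injOn_Icc' hab hi with hm | hm
  · exact mem_of_superset (Icc_mem_nhds (hm (Set.left_mem_Icc.2 hab) hsI hs.1)
      (hm hsI (Set.right_mem_Icc.2 hab) hs.2)) (intermediate_value_Icc hab hc)
  · exact mem_of_superset (Icc_mem_nhds (hm hsI (Set.right_mem_Icc.2 hab) hs.2)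
      (hm (Set.left_mem_Icc.2 hab) hsI hs.1)) (intermediate_value_Icc' hab hc)

/-- Within `C` the set `A` is open, being open in `M`, and closed, being equal to `K ∩ C`. -/
theorem IsPreconnected.subset_of_mem_nhdsWithin {M A K C : Set Plane} (hC : IsPreconnected C)
    (hCM : C ⊆ M) (hA : ∀ y ∈ A, A ∈ 𝓝[M] y) (hK : IsClosed K) (hAK : A ⊆ K) (hKC : K ∩ C ⊆ A)
    (hne : (C ∩ A).Nonempty) : C ⊆ A := by
  intro y hy
  by_contra hyA
  have hA' : A ⊆ interior (A ∪ Mᶜ) := by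
    intro x hx
    rw [mem_interior_iff_mem_nhds]
    obtain ⟨V, hV, hVA⟩ := mem_nhdsWithin_iff_exists_mem_nhds_inter.1 (hA x hx)
    refine mem_of_superset hV fun v hv => ?_
    by_cases hvM : v ∈ M
    exacts [Or.inl (hVA ⟨hv, hvM⟩), Or.inr hvM]
  obtain ⟨x, hx⟩ := hne
  obtain ⟨v, hvC, hv1, hv2⟩ := hC _ Kᶜ isOpen_interior hK.isOpen_compl (fun v hv => by
    by_cases hvK : v ∈ K
    exacts [Or.inl (hA' (hKC ⟨hvK, hv⟩)), Or.inr hvK]) ⟨x, hx.1, hA' hx.2⟩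
    ⟨y, hy, fun hyK => hyA (hKC ⟨hyK, hy⟩)⟩
  rcases interior_subset hv1 with h1 | h1
  exacts [hv2 (hAK h1), h1 (hCM hvC)]

theorem openSegment_eq_image_lineMap' (p q : Plane) :
    openSegment ℝ p q = AffineMap.lineMap p q '' Set.Ioo (0 : ℝ) 1 :=
  openSegment_eq_image_lineMap ℝ p q

theorem eq_or_mem_openSegment {p q x : Plane} (hx : x ∈ segment ℝ p q) :
    x = p ∨ x = q ∨ x ∈ openSegment ℝ p q := by
  rw [← insert_endpoints_openSegment] at hx
  exact hx

namespace HasTangentReach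

variable {M : Set Plane} {ε : ℝ} {T : Plane → Plane} (h : HasTangentReach M ε T)
include h

/-- An injective path in the curve covers a neighbourhood of each of its interior points. -/
theorem image_mem_nhdsWithin {c : ℝ → Plane} {a b s : ℝ} (hs : s ∈ Set.Ioo a b)
    (hc : ContinuousOn c (Set.Ioo a b)) (hi : Set.InjOn c (Set.Ioo a b))
    (hM : ∀ u ∈ Set.Ioo a b, c u ∈ M) : c '' Set.Ioo a b ∈ 𝓝[M] (c s) := by
  obtain ⟨γ, t, hγ, ht⟩ := h.exists_chart (c s) (hM s hs)
  have hnhds : Set.Ioo a b ∈ 𝓝 s := Ioo_mem_nhds hs.1 hs.2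
  have hlim : Tendsto c (𝓝 s) (𝓝[M] (c s)) :=
    tendsto_nhdsWithin_iff.2 ⟨hc.continuousAt hnhds, by filter_upwards [hnhds] with u hu using hM u hu⟩
  have hev : ∀ᶠ u in 𝓝 s, c u ∈ Set.range γ := by
    refine hlim.eventually ?_
    rw [← ht, ← hγ.map_nhds]
    exact Filter.range_mem_map
  obtain ⟨δ, hδ, hball⟩ := Metric.eventually_nhds_iff_ball.1 (hev.and hnhds)
  have hsub : Set.Icc (s - δ / 2) (s + δ / 2) ⊆ Metric.ball s δ := by
    rw [← Real.closedBall_eq_Icc]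
    exact Metric.closedBall_subset_ball (by linarith)
  set I := Set.Icc (s - δ / 2) (s + δ / 2) with hI
  have hIab : I ⊆ Set.Ioo a b := fun u hu => (hball u (hsub hu)).2
  set τ : ℝ → ℝ := fun u => Function.invFun γ (c u) with hτ
  have hγτ : ∀ u ∈ I, γ (τ u) = c u := fun u hu => Function.invFun_eq (hball u (hsub hu)).1
  have hτc : ContinuousOn τ I := by
    rw [hγ.isEmbedding.isInducing.continuousOn_iff]
    exact (hc.mono hIab).congr hγτ
  have hτi : Set.InjOn τ I := fun u hu v hv huv =>
    hi (hIab hu) (hIab hv) (by rw [← hγτ u hu, ← hγτ v hv, huv])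
  have hsI : s ∈ Set.Ioo (s - δ / 2) (s + δ / 2) := ⟨by linarith, by linarith⟩
  have h1 := image_mem_nhds_of_injOn hsI hτc hτi
  rw [← hγτ s (Set.Ioo_subset_Icc_self hsI), ← hγ.map_nhds]
  refine mem_of_superset (Filter.image_mem_map h1) ?_
  rintro _ ⟨_, ⟨u, hu, rfl⟩, rfl⟩
  exact ⟨u, hIab hu, (hγτ u hu).symm⟩

variable {S : Set Plane} (hS : S ⊆ M)
include hS

theorem openArc_mem_nhdsWithin {p q : Plane} (he : IsEdge S ε p q) {y : Plane}
    (hy : y ∈ nearest M '' openSegment ℝ p q) : nearest M '' openSegment ℝ p q ∈ 𝓝[M] y := by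
  have hp := hS he.left_mem
  have hq := hS he.right_mem
  rw [openSegment_eq_image_lineMap', Set.image_image] at hy ⊢
  obtain ⟨u, hu, rfl⟩ := hy
  have hmem : ∀ v ∈ Set.Ioo (0 : ℝ) 1, AffineMap.lineMap p q v ∈ segment ℝ p q := fun v hv =>
    mem_segment_iff_lineMap.2 ⟨v, Set.Ioo_subset_Icc_self hv, rfl⟩
  refine h.image_mem_nhdsWithin (c := fun v => nearest M (AffineMap.lineMap p q v)) hu ?_ ?_
    fun v _ => h.nearest_mem hp
  · exact (h.continuousOn_nearest_segment hp hq he.dist_lt).comp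
      AffineMap.lineMap_continuous.continuousOn hmem
  · intro v hv v' hv' heq
    exact AffineMap.lineMap_injective ℝ he.ne
      (h.injOn_nearest_segment hp hq he.dist_lt (hmem v hv) (hmem v' hv') heq)

theorem nearest_notMem_of_mem_openSegment {p q x : Plane} (he : IsEdge S ε p q)
    (hx : x ∈ openSegment ℝ p q) : nearest M x ∉ S := by
  intro hmem
  rw [openSegment_eq_image_lineMap'] at hx
  obtain ⟨u, hu, rfl⟩ := hx
  rcases h.mem_endpoints_of_nearest_mem hS he
    (mem_segment_iff_lineMap.2 ⟨u, Set.Ioo_subset_Icc_self hu, rfl⟩) hmem with h1 | h1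
  · have h2 : AffineMap.lineMap p q u = AffineMap.lineMap p q (0 : ℝ) := by simpa using h1
    exact hu.1.ne' (AffineMap.lineMap_injective ℝ he.ne h2)
  · have h2 : AffineMap.lineMap p q u = AffineMap.lineMap p q (1 : ℝ) := by simpa using h1
    exact hu.2.ne (AffineMap.lineMap_injective ℝ he.ne h2)

/-- The open arc over `p q` is open in `M`, and its closed arc adds only the samples `p` and `q`,
which the open arc of the other edge avoids. -/
theorem openArc_subset {p q p' q' : Plane} (he : IsEdge S ε p q) (he' : IsEdge S ε p' q')
    (hne : (nearest M '' openSegment ℝ p' q' ∩ nearest M '' openSegment ℝ p q).Nonempty) :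
    nearest M '' openSegment ℝ p' q' ⊆ nearest M '' openSegment ℝ p q := by
  have hp := hS he.left_mem
  have hq := hS he.right_mem
  have hp' := hS he'.left_mem
  have hpre : IsPreconnected (nearest M '' openSegment ℝ p' q') :=
    (convex_openSegment p' q').isPreconnected.image _
      ((h.continuousOn_nearest_segment hp' (hS he'.right_mem) he'.dist_lt).mono
        (openSegment_subset_segment ℝ p' q'))
  refine hpre.subset_of_mem_nhdsWithin (M := M) (K := projectedArc M p q) ?_
    (fun y hy => h.openArc_mem_nhdsWithin hS he hy)
    (h.isCompact_projectedArc hp hq he.dist_lt).isClosed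
    (Set.image_mono (openSegment_subset_segment ℝ p q)) ?_ hne
  · rintro _ ⟨w, -, rfl⟩
    exact h.nearest_mem hp'
  · rintro y ⟨⟨w, hw, rfl⟩, w', hw', heq⟩
    have hnot := h.nearest_notMem_of_mem_openSegment hS he' hw'
    rw [heq] at hnot
    rcases eq_or_mem_openSegment hw with rfl | rfl | hw
    · exact absurd he.left_mem (by rwa [h.nearest_self hp] at hnot)
    · exact absurd he.right_mem (by rwa [h.nearest_self hq] at hnot)
    · exact ⟨w, hw, rfl⟩

theorem endpoints_of_openArc_subset {p q p' q' r : Plane} (he : IsEdge S ε p q)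
    (he' : IsEdge S ε p' q')
    (hsub : nearest M '' openSegment ℝ p' q' ⊆ nearest M '' openSegment ℝ p q)
    (hr : r ∈ segment ℝ p' q') (hrS : r ∈ S) : r = p ∨ r = q := by
  have hp := hS he.left_mem
  have hq := hS he.right_mem
  have h1 : nearest M r ∈ closure (nearest M '' openSegment ℝ p' q') :=
    (h.continuousAt_nearest_of_mem_segment (hS he'.left_mem) (hS he'.right_mem) he'.dist_lt
      hr).continuousWithinAt.mem_closure_image (segment_subset_closure_openSegment hr)
  have h2 : nearest M r ∈ projectedArc M p q :=
    closure_minimal (hsub.trans (Set.image_mono (openSegment_subset_segment ℝ p q)))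
      (h.isCompact_projectedArc hp hq he.dist_lt).isClosed h1
  rw [h.nearest_self (hS hrS)] at h2
  obtain ⟨w, hw, rfl⟩ := h2
  rcases h.mem_endpoints_of_nearest_mem hS he hw hrS with rfl | rfl
  · left; exact h.nearest_self hp
  · right; exact h.nearest_self hq

/-- Open arcs that meet are nested. Taking closures, the endpoints of the inner one are samples on
the closed outer arc, hence its endpoints. -/
theorem segment_eq_of_openArc_inter {p q p' q' : Plane} (he : IsEdge S ε p q)
    (he' : IsEdge S ε p' q')
    (hne : (nearest M '' openSegment ℝ p' q' ∩ nearest M '' openSegment ℝ p q).Nonempty) :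
    segment ℝ p' q' = segment ℝ p q := by
  have hsub := h.openArc_subset hS he he' hne
  have h1 := h.endpoints_of_openArc_subset hS he he' hsub (left_mem_segment ℝ p' q') he'.left_mem
  have h2 := h.endpoints_of_openArc_subset hS he he' hsub (right_mem_segment ℝ p' q') he'.right_mem
  rcases h1 with rfl | rfl <;> rcases h2 with rfl | rfl
  · exact absurd rfl he'.ne
  · rfl
  · exact segment_symm ℝ _ _
  · exact absurd rfl he'.ne

theorem mem_or_mem_openSegment_of_mem_edgePolygon {x : Plane} (hx : x ∈ edgePolygon S ε) :
    (x ∈ S ∧ nearest M x = x) ∨ ∃ p q, IsEdge S ε p q ∧ x ∈ openSegment ℝ p q := by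
  rcases hx with hx | ⟨p, q, he, hx⟩
  · exact Or.inl ⟨hx, h.nearest_self (hS hx)⟩
  · rcases eq_or_mem_openSegment hx with rfl | rfl | hx
    · exact Or.inl ⟨he.left_mem, h.nearest_self (hS he.left_mem)⟩
    · exact Or.inl ⟨he.right_mem, h.nearest_self (hS he.right_mem)⟩
    · exact Or.inr ⟨p, q, he, hx⟩

theorem injOn_nearest_edgePolygon : Set.InjOn (nearest M) (edgePolygon S ε) := by
  intro x hx x' hx' heq
  rcases h.mem_or_mem_openSegment_of_mem_edgePolygon hS hx with ⟨h1, h2⟩ | ⟨p, q, he, h1⟩ <;>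
  rcases h.mem_or_mem_openSegment_of_mem_edgePolygon hS hx' with ⟨h3, h4⟩ | ⟨p', q', he', h3⟩
  · rw [← h2, ← h4, heq]
  · refine absurd ?_ (h.nearest_notMem_of_mem_openSegment hS he' h3)
    rwa [← heq, h2]
  · refine absurd ?_ (h.nearest_notMem_of_mem_openSegment hS he h1)
    rwa [heq, h4]
  · have h5 := h.segment_eq_of_openArc_inter hS he he' ⟨_, ⟨x', h3, rfl⟩, ⟨x, h1, heq⟩⟩
    have h6 := openSegment_subset_segment ℝ p' q' h3
    rw [h5] at h6
    exact h.injOn_nearest_segment (hS he.left_mem) (hS he.right_mem) he.dist_lt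
      (openSegment_subset_segment ℝ p q h1) h6 heq

end HasTangentReach

/-! ### Rotating discs about a sample: an edge on each side. -/

theorem quarterTurn_neg (v : Plane) : quarterTurn (-v) = -quarterTurn v := by
  ext i; fin_cases i <;> simp

/-- The point at angle `θ` on the circle of radius `ε` about `s`, measured clockwise from the
normal direction `quarterTurn t`. -/
noncomputable def circlePoint (s t : Plane) (ε θ : ℝ) : Plane :=
  s + (ε * Real.cos θ) • quarterTurn t + (ε * Real.sin θ) • t

theorem continuous_circlePoint (s t : Plane) (ε : ℝ) : Continuous (circlePoint s t ε) := by
  unfold circlePoint; fun_prop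

theorem circlePoint_zero (s t : Plane) (ε : ℝ) : circlePoint s t ε 0 = s + ε • quarterTurn t := by
  simp [circlePoint]

theorem dist_circlePoint {s t : Plane} {ε : ℝ} (hε : 0 < ε) (ht : ‖t‖ = 1) (θ : ℝ) :
    dist (circlePoint s t ε θ) s = ε := by
  refine (sq_eq_sq₀ dist_nonneg hε.le).1 ?_
  have h1 : t 0 ^ 2 + t 1 ^ 2 = 1 := by rw [← plane_norm_sq, ht, one_pow]
  have h2 := Real.sin_sq_add_cos_sq θ
  rw [plane_dist_sq, circlePoint]
  simp only [PiLp.add_apply, PiLp.smul_apply, smul_eq_mul, quarterTurn_zero, quarterTurn_one]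
  linear_combination (ε ^ 2 * (Real.sin θ ^ 2 + Real.cos θ ^ 2)) * h1 + ε ^ 2 * h2

theorem inner_circlePoint (s t v : Plane) (ε θ : ℝ) :
    (inner ℝ (circlePoint s t ε θ - s) v : ℝ) =
      ε * (Real.cos θ * inner ℝ v (quarterTurn t) + Real.sin θ * inner ℝ v t) := by
  rw [plane_inner, plane_inner, plane_inner, circlePoint]
  simp only [PiLp.add_apply, PiLp.sub_apply, PiLp.smul_apply, smul_eq_mul, quarterTurn_zero,
    quarterTurn_one]
  ring

theorem inner_quarterTurn_circlePoint (s t v : Plane) (ε θ : ℝ) :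
    (inner ℝ v (quarterTurn (circlePoint s t ε θ - s)) : ℝ) =
      ε * (Real.sin θ * inner ℝ v (quarterTurn t) - Real.cos θ * inner ℝ v t) := by
  rw [plane_inner, plane_inner, plane_inner, circlePoint]
  simp only [PiLp.add_apply, PiLp.sub_apply, PiLp.smul_apply, smul_eq_mul, quarterTurn_zero,
    quarterTurn_one]
  ring

theorem inner_circlePoint_add (s t v : Plane) (ε θ η : ℝ) :
    (inner ℝ (circlePoint s t ε (θ + η) - s) v : ℝ) =
      Real.cos η * inner ℝ (circlePoint s t ε θ - s) v -
      Real.sin η * inner ℝ v (quarterTurn (circlePoint s t ε θ - s)) := by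
  rw [inner_circlePoint, inner_circlePoint, inner_quarterTurn_circlePoint, Real.cos_add,
    Real.sin_add]
  ring

theorem dist_sq_eq_of_dist_eq {c s r : Plane} {ε : ℝ} (hc : dist c s = ε) :
    dist c r ^ 2 = ε ^ 2 + dist r s ^ 2 - 2 * inner ℝ (c - s) (r - s) := by
  rw [← hc, plane_dist_sq, plane_dist_sq, plane_dist_sq, plane_inner]
  simp only [PiLp.sub_apply]
  ring

/-- The rotational analogue of `eventually_push`: samples on the circle lie on the side that the
rotation moves away from. -/
theorem eventually_rotate {S : Set Plane} (hS : S.Finite) {ε : ℝ} (hε : 0 < ε) {s t : Plane} {θ : ℝ}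
    (ht : ‖t‖ = 1) (hz : ∀ r ∈ S, ε ≤ dist (circlePoint s t ε θ) r)
    (hside : ∀ r ∈ S, dist (circlePoint s t ε θ) r = ε →
      (0 : ℝ) ≤ inner ℝ (r - s) (quarterTurn (circlePoint s t ε θ - s))) :
    ∀ᶠ η in 𝓝[>] (0 : ℝ), ∀ r ∈ S, ε ≤ dist (circlePoint s t ε (θ + η)) r := by
  refine (Filter.eventually_all_finite hS).2 fun r hr => ?_
  rcases (hz r hr).eq_or_lt with he | hlt
  · filter_upwards [Ioo_mem_nhdsGT Real.pi_pos] with η hη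
    have h1 := hside r hr he.symm
    have h2 := dist_sq_eq_of_dist_eq (r := r) (dist_circlePoint (s := s) hε ht θ)
    have h3 := dist_sq_eq_of_dist_eq (r := r) (dist_circlePoint (s := s) hε ht (θ + η))
    rw [← he] at h2
    rw [inner_circlePoint_add] at h3
    refine (sq_le_sq₀ hε.le dist_nonneg).1 ?_
    have h4 := mul_nonneg (Real.sin_nonneg_of_nonneg_of_le_pi hη.1.le hη.2.le) h1
    have h5 : 0 ≤ (1 - Real.cos η) * inner ℝ (circlePoint s t ε θ - s) (r - s) :=
      mul_nonneg (sub_nonneg.2 (Real.cos_le_one η)) (by nlinarith [sq_nonneg (dist r s)])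
    linarith
  · have hc : Tendsto (fun η : ℝ => dist (circlePoint s t ε (θ + η)) r) (𝓝[>] 0)
        (𝓝 (dist (circlePoint s t ε (θ + 0)) r)) :=
      ((((continuous_circlePoint s t ε).comp (continuous_const.add continuous_id)).dist
        continuous_const).tendsto 0).mono_left nhdsWithin_le_nhds
    rw [add_zero] at hc
    filter_upwards [hc.eventually (lt_mem_nhds hlt)] with η hη using hη.le

namespace HasTangentReach

variable {M : Set Plane} {ε : ℝ} {T : Plane → Plane} (h : HasTangentReach M ε T)
include h

theorem neg : HasTangentReach M ε (fun y => -T y) where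
  pos := h.pos
  isCompact := h.isCompact
  norm_tangent y hy := by rw [norm_neg, h.norm_tangent y hy]
  reach y hy a ha := by
    rw [quarterTurn_neg, inner_neg_right, abs_neg]; exact h.reach y hy a ha
  continuousOn v := by
    simpa only [inner_neg_right, neg_smul, smul_neg, neg_neg] using h.continuousOn v
  inner_of_isLocalExtrOn c y hy hl := by
    rw [inner_neg_right, h.inner_of_isLocalExtrOn c y hy hl, neg_zero]
  exists_chart := h.exists_chart
  exists_right y hy δ hδ := by
    simpa only [inner_neg_right, neg_pos] using h.exists_left y hy δ hδ
  exists_left y hy δ hδ := by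
    simpa only [inner_neg_right, neg_lt_zero] using h.exists_right y hy δ hδ

/-- Take a point `v` of `M` farthest from `s` in the right half of the closed `ε`-disc. If it were
interior to the disc, it would be a local maximum of the distance on `M`, so `v - s` would be normal
at `v` and `v = s`. -/
theorem exists_right_dist_eq {s : Plane} (hs : s ∈ M) :
    ∃ y ∈ M, dist y s = ε ∧ 0 < (inner ℝ (y - s) (T s) : ℝ) := by
  by_contra! hno
  have hε := h.pos
  have hcont : Continuous fun v : Plane => (inner ℝ (v - s) (T s) : ℝ) := by fun_prop
  have hcd : Continuous fun v : Plane => dist v s := by fun_prop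
  set A : Set Plane := {v | dist v s ≤ ε} ∩ {v | 0 ≤ (inner ℝ (v - s) (T s) : ℝ)} with hA
  have hAc : IsCompact (M ∩ A) := h.isCompact.inter_right
    ((isClosed_le hcd continuous_const).inter (isClosed_le continuous_const hcont))
  obtain ⟨a, ha, has, hapos⟩ := h.exists_right s hs ε hε
  obtain ⟨v, hv, hmax⟩ := hAc.exists_isMaxOn
    ⟨a, ha, by rw [Set.mem_ofPred_eq, dist_eq_norm]; exact has.le, hapos.le⟩ hcd.continuousOn
  have hne : v ≠ s := by
    rintro rfl
    have h1 : dist a v ≤ dist v v := hmax (show a ∈ M ∩ A from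
      ⟨ha, by rw [Set.mem_ofPred_eq, dist_eq_norm]; exact has.le, hapos.le⟩)
    rw [dist_self] at h1
    rw [dist_le_zero.1 h1, sub_self, inner_zero_left] at hapos
    exact lt_irrefl _ hapos
  have hvpos : 0 < (inner ℝ (v - s) (T s) : ℝ) := by
    refine lt_of_le_of_ne hv.2.2 fun h0 => hne ?_
    exact h.eq_of_inner_eq_zero hs hv.1 (lt_of_le_of_lt hv.2.1 (by linarith)) h0.symm
  have hvlt : dist v s < ε := lt_of_le_of_ne hv.2.1 fun he => absurd (hno v hv.1 he) (not_le.2 hvpos)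
  have hl : IsLocalExtrOn (fun z => ‖z - s‖ ^ 2) M v := by
    right
    have e1 : ∀ᶠ z in 𝓝[M] v, dist z s < ε :=
      (hcd.tendsto v).eventually (gt_mem_nhds hvlt) |>.filter_mono nhdsWithin_le_nhds
    have e2 : ∀ᶠ z in 𝓝[M] v, 0 < (inner ℝ (z - s) (T s) : ℝ) :=
      (hcont.tendsto v).eventually (lt_mem_nhds hvpos) |>.filter_mono nhdsWithin_le_nhds
    filter_upwards [e1, e2, self_mem_nhdsWithin] with z h1 h2 hz
    have h3 : dist z s ≤ dist v s := hmax (show z ∈ M ∩ A from ⟨hz, h1.le, h2.le⟩)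
    rw [dist_eq_norm, dist_eq_norm] at h3
    gcongr
  have h1 := h.inner_of_isLocalExtrOn s v hv.1 hl
  refine hne (h.eq_of_inner_eq_zero hv.1 hs (by rw [dist_comm]; linarith) ?_).symm
  rw [← neg_sub, inner_neg_left, h1, neg_zero]

variable {S : Set Plane} (hS : S ⊆ M)
include hS

/-- A sample covers the point `y` at distance `ε` on the right. If it were not on the right, its
projected arc to `y` would pass through `s`; but that arc stays within less than `ε` of `y`. -/
theorem exists_right_sample (hcover : M ⊆ ballUnion S ε) {s : Plane} (hs : s ∈ M) :
    ∃ a ∈ S, dist a s < 2 * ε ∧ 0 < (inner ℝ (a - s) (T s) : ℝ) := by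
  have hε := h.pos
  obtain ⟨y, hy, hys, hypos⟩ := h.exists_right_dist_eq hs
  obtain ⟨a, ha, hya⟩ := mem_ballUnion.1 (hcover hy)
  have has : dist a s < 2 * ε := by linarith [dist_triangle_left a s y]
  refine ⟨a, ha, has, ?_⟩
  by_contra! hle
  have hcont : Continuous fun v : Plane => (inner ℝ (v - s) (T s) : ℝ) := by fun_prop
  have hay : dist a y < 2 * ε := by rw [dist_comm]; linarith
  obtain ⟨_, ⟨w, hw, rfl⟩, h0⟩ := (h.isPreconnected_projectedArc (hS ha) hy hay).intermediate_value
    (h.left_mem_projectedArc (hS ha)) (h.right_mem_projectedArc hy) hcont.continuousOn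
    ⟨hle, hypos.le⟩
  have h1 := h.dist_nearest_right_le (hS ha) hw
  rw [dist_comm a y] at h1
  have h2 : nearest M w = s := h.eq_of_inner_eq_zero hs (h.nearest_mem hy)
    (by linarith [dist_triangle (nearest M w) y s]) h0
  rw [h2, dist_comm] at h1
  linarith

/-- Rotate a disc through `s` from the tangent position, which is empty, towards the right. At the
last empty angle before `a` is covered, a sample blocks the rotation and yields an edge. The reach
inequality excludes that the edge goes to the left. -/
theorem exists_isEdge_right (hSfin : S.Finite) (hcover : M ⊆ ballUnion S ε) {s : Plane}
    (hs : s ∈ S) : ∃ q, IsEdge S ε s q ∧ 0 < (inner ℝ (q - s) (T s) : ℝ) := by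
  have hε := h.pos
  have ht := h.norm_tangent s (hS hs)
  obtain ⟨a, ha, has, hapos⟩ := h.exists_right_sample hS hcover (hS hs)
  set c := circlePoint s (T s) ε with hc
  have hcs : ∀ θ, dist (c θ) s = ε := dist_circlePoint hε ht
  have hane : 0 < dist a s := by
    refine dist_pos.2 fun he => ?_
    rw [he, sub_self, inner_zero_left] at hapos
    exact lt_irrefl _ hapos
  set x : ℝ := inner ℝ (a - s) (quarterTurn (T s)) / dist a s with hx
  have hdecomp := inner_eq_of_unit ht (a - s) (a - s)
  rw [real_inner_self_eq_norm_sq, ← dist_eq_norm] at hdecomp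
  have hxsq : 1 - x ^ 2 = (inner ℝ (a - s) (T s) / dist a s) ^ 2 := by
    rw [hx, div_pow, div_pow, hdecomp, eq_div_iff (by rw [← hdecomp]; positivity), sub_mul,
      div_mul_cancel₀ _ (by rw [← hdecomp]; positivity)]
    ring
  have hx1 : x ^ 2 < 1 := by
    have : 0 < (inner ℝ (a - s) (T s) / dist a s : ℝ) ^ 2 := by positivity
    linarith
  have hx2 := abs_lt.1 ((sq_lt_one_iff_abs_lt_one x).1 hx1)
  -- At this angle the centre is in the direction of `a` from `s`, so its distance to `a` is `|ε -
  -- dist a s| < ε`.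
  set φ := Real.arccos x with hφ
  have hcos : Real.cos φ = x := Real.cos_arccos hx2.1.le hx2.2.le
  have hsin : Real.sin φ = inner ℝ (a - s) (T s) / dist a s := by
    rw [hφ, Real.sin_arccos, hxsq, Real.sqrt_sq (by positivity)]
  have hφ0 : 0 ≤ φ := Real.arccos_nonneg x
  have hφπ : φ < Real.pi := by
    refine lt_of_le_of_ne (Real.arccos_le_pi x) fun he => ?_
    have : Real.sin φ = 0 := by rw [he, Real.sin_pi]
    rw [hsin] at this
    exact (div_pos hapos hane).ne' this
  have hcovered : dist (c φ) a < ε := by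
    have h1 := dist_sq_eq_of_dist_eq (r := a) (hcs φ)
    have h2 : (inner ℝ (c φ - s) (a - s) : ℝ) = ε * dist a s := by
      rw [hc, inner_circlePoint, hcos, hsin, hx]
      field_simp
      linarith
    rw [h2] at h1
    refine lt_of_pow_lt_pow_left₀ 2 hε.le ?_
    nlinarith
  set B : Set ℝ := Set.Icc 0 φ ∩ {θ | ∀ r ∈ S, ε ≤ dist (c θ) r} with hB
  have hBc : IsCompact B := by
    refine isCompact_Icc.inter_right ?_
    simp only [Set.ofPred_forall]
    exact isClosed_biInter fun r _ => isClosed_le continuous_const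
      ((continuous_circlePoint s (T s) ε).dist continuous_const)
  have h0B : (0 : ℝ) ∈ B := by
    refine ⟨⟨le_rfl, hφ0⟩, fun r hr => ?_⟩
    rw [hc, circlePoint_zero]
    refine h.le_dist_pole (hS hs) (hS hr) ?_ (by rw [norm_quarterTurn, ht])
    rw [real_inner_comm]; exact inner_quarterTurn_self _
  obtain ⟨θ, ⟨⟨hθ0, hθφ⟩, hθc⟩, hmax⟩ := hBc.exists_isGreatest ⟨0, h0B⟩
  have hθlt : θ < φ := lt_of_le_of_ne hθφ fun he => absurd (hθc a ha) (by
    rw [he]; exact not_le.2 hcovered)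
  obtain ⟨r, hr, hzr, hside⟩ : ∃ r ∈ S, dist (c θ) r = ε ∧
      (inner ℝ (r - s) (quarterTurn (c θ - s)) : ℝ) < 0 := by
    by_contra! hno
    obtain ⟨η, h1, h2⟩ := ((eventually_rotate hSfin hε ht hθc hno).and
      (Ioo_mem_nhdsGT (sub_pos.2 hθlt))).exists
    have h3 : θ + η ≤ θ := hmax ⟨⟨by linarith [h2.1], by linarith [h2.2]⟩, h1⟩
    linarith [h2.1]
  obtain ⟨q, he, hzq, hq⟩ := h.exists_isEdge_of_side hS hSfin (D := -1) hθc hs (hcs θ) hr hzr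
    (by linarith)
  refine ⟨q, he, ?_⟩
  by_contra! hle
  have hqlt : (inner ℝ (q - s) (T s) : ℝ) < 0 := by
    refine lt_of_le_of_ne hle fun h0 => he.ne ?_
    exact (h.eq_of_inner_eq_zero (hS hs) (hS he.right_mem)
      (by rw [dist_comm]; exact he.dist_lt) h0).symm
  have h1 := two_mul_inner_sub_eq_of_dist_eq (hzq.trans (hcs θ).symm)
  rw [hc, inner_circlePoint] at h1
  have h2 := h.reach s (hS hs) q (hS he.right_mem)
  rw [← h1] at h2
  rw [hc, inner_quarterTurn_circlePoint] at hq
  -- For `q` on the left the sine term is negative unless `θ = 0`; in the tangent position itself,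
  -- the side condition on `q` means that `q` is on the right.
  have h3 : |(inner ℝ (q - s) (quarterTurn (T s)) : ℝ)| ≤
      Real.cos θ * inner ℝ (q - s) (quarterTurn (T s)) + Real.sin θ * inner ℝ (q - s) (T s) := by
    refine le_of_mul_le_mul_left ?_ hε
    linarith
  have h4 : Real.cos θ * inner ℝ (q - s) (quarterTurn (T s)) ≤
      |(inner ℝ (q - s) (quarterTurn (T s)) : ℝ)| := by
    refine (le_abs_self _).trans ?_
    rw [abs_mul]
    exact mul_le_of_le_one_left (abs_nonneg _) (Real.abs_cos_le_one θ)
  have hθ : θ = 0 := by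
    refine (hθ0.eq_or_lt.resolve_right fun hpos => ?_).symm
    have h5 := Real.sin_pos_of_pos_of_lt_pi hpos (hθlt.trans hφπ)
    linarith [mul_neg_of_pos_of_neg h5 hqlt]
  rw [hθ, Real.sin_zero, Real.cos_zero] at hq
  have := mul_neg_of_pos_of_neg hε hqlt
  linarith

theorem exists_isEdge_left (hSfin : S.Finite) (hcover : M ⊆ ballUnion S ε) {s : Plane}
    (hs : s ∈ S) : ∃ q, IsEdge S ε s q ∧ (inner ℝ (q - s) (T s) : ℝ) < 0 := by
  simpa only [inner_neg_right, neg_pos] using h.neg.exists_isEdge_right hS hSfin hcover hs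

/-! ### The projection of the polygon is onto. -/

theorem image_edgePolygon_mem_nhdsWithin_sample (hSfin : S.Finite) (hcover : M ⊆ ballUnion S ε)
    {s : Plane} (hs : s ∈ S) : nearest M '' edgePolygon S ε ∈ 𝓝[M] s := by
  obtain ⟨q, heq, hq⟩ := h.exists_isEdge_right hS hSfin hcover hs
  obtain ⟨p, hep, hp⟩ := h.exists_isEdge_left hS hSfin hcover hs
  -- The broken line from `p` through `s` to `q`. Its tangential coordinate at `s` is strictly
  -- increasing, so it is injective, and its projection covers a neighbourhood of `s` in `M`.
  set w : ℝ → Plane := fun u => s + (max u 0) • (q - s) + (max (-u) 0) • (p - s) with hw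
  have hwseg : ∀ u ∈ Set.Ioo (-1 : ℝ) 1, w u ∈ segment ℝ s q ∨ w u ∈ segment ℝ s p := by
    intro u hu
    rcases le_total 0 u with h0 | h0
    · left
      refine mem_segment_iff_lineMap.2 ⟨u, ⟨h0, hu.2.le⟩, ?_⟩
      simp only [hw, max_eq_left h0, max_eq_right (neg_nonpos.2 h0), zero_smul, add_zero,
        AffineMap.lineMap_apply_module', add_comm]
    · right
      refine mem_segment_iff_lineMap.2 ⟨-u, ⟨neg_nonneg.2 h0, by linarith [hu.1]⟩, ?_⟩
      simp only [hw, max_eq_right h0, max_eq_left (neg_nonneg.2 h0), zero_smul, add_zero,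
        AffineMap.lineMap_apply_module', add_comm]
  have hwmem : ∀ u ∈ Set.Ioo (-1 : ℝ) 1, w u ∈ edgePolygon S ε := by
    intro u hu
    rcases hwseg u hu with h1 | h1
    exacts [Or.inr ⟨s, q, heq, h1⟩, Or.inr ⟨s, p, hep, h1⟩]
  have hwc : Continuous w := by rw [hw]; fun_prop
  have hwinner : ∀ u, (inner ℝ (w u - s) (T s) : ℝ) =
      max u 0 * inner ℝ (q - s) (T s) + max (-u) 0 * inner ℝ (p - s) (T s) := by
    intro u
    have : w u - s = max u 0 • (q - s) + max (-u) 0 • (p - s) := by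
      rw [hw]; module
    rw [this, inner_add_left, inner_smul_left, inner_smul_left]; rfl
  have hwmono : StrictMono fun u => (inner ℝ (w u - s) (T s) : ℝ) := by
    intro u v huv
    simp only [hwinner]
    rcases le_total 0 u with hu | hu <;> rcases le_total 0 v with hv | hv
    · rw [max_eq_left hu, max_eq_left hv, max_eq_right (neg_nonpos.2 hu),
        max_eq_right (neg_nonpos.2 hv)]
      nlinarith
    · exact absurd huv (not_lt.2 (hv.trans hu))
    · rw [max_eq_right hu, max_eq_left hv, max_eq_left (neg_nonneg.2 hu),
        max_eq_right (neg_nonpos.2 hv)]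
      rcases hu.eq_or_lt with h0 | h0
      · nlinarith
      · nlinarith [mul_pos_of_neg_of_neg h0 hp, mul_nonneg hv hq.le]
    · rw [max_eq_right hu, max_eq_right hv, max_eq_left (neg_nonneg.2 hu),
        max_eq_left (neg_nonneg.2 hv)]
      nlinarith
  have hw0 : w 0 = s := by simp [hw]
  have hM : s ∈ M := hS hs
  have key := h.image_mem_nhdsWithin (c := fun u => nearest M (w u)) (a := -1) (b := 1) (s := 0)
    (by norm_num) (fun u hu => by
      refine (ContinuousAt.comp (g := nearest M) (f := w) ?_ hwc.continuousAt).continuousWithinAt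
      rcases hwseg u hu with h1 | h1
      · exact h.continuousAt_nearest_of_mem_segment hM (hS heq.right_mem) heq.dist_lt h1
      · exact h.continuousAt_nearest_of_mem_segment hM (hS hep.right_mem) hep.dist_lt h1)
    (fun u hu v hv huv => hwmono.injective (by
      have := h.injOn_nearest_edgePolygon hS (hwmem u hu) (hwmem v hv) huv
      simp only [this]))
    (fun u _ => h.nearest_mem hM)
  simp only [hw0, h.nearest_self hM] at key
  refine mem_of_superset key ?_
  rintro _ ⟨u, hu, rfl⟩
  exact ⟨w u, hwmem u hu, rfl⟩

theorem image_edgePolygon_mem_nhdsWithin (hSfin : S.Finite) (hcover : M ⊆ ballUnion S ε)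
    {y : Plane} (hy : y ∈ nearest M '' edgePolygon S ε) :
    nearest M '' edgePolygon S ε ∈ 𝓝[M] y := by
  obtain ⟨x, hx, rfl⟩ := hy
  rcases h.mem_or_mem_openSegment_of_mem_edgePolygon hS hx with ⟨h1, h2⟩ | ⟨p, q, he, h1⟩
  · rw [h2]; exact h.image_edgePolygon_mem_nhdsWithin_sample hS hSfin hcover h1
  · refine mem_of_superset (h.openArc_mem_nhdsWithin hS he ⟨x, h1, rfl⟩) (Set.image_mono ?_)
    exact fun v hv => Or.inr ⟨p, q, he, openSegment_subset_segment ℝ p q hv⟩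

omit h hS in
theorem isCompact_edgePolygon (hSfin : S.Finite) : IsCompact (edgePolygon S ε) := by
  have h1 : edgePolygon S ε = S ∪
      ⋃ e ∈ {e : Plane × Plane | IsEdge S ε e.1 e.2}, segment ℝ e.1 e.2 := by
    ext x; simp [edgePolygon]
  rw [h1]
  refine hSfin.isCompact.union (Set.Finite.isCompact_biUnion ?_ fun e _ => ?_)
  · exact (hSfin.prod hSfin).subset fun e he => ⟨he.left_mem, he.right_mem⟩
  · rw [segment_eq_image_lineMap]
    exact isCompact_Icc.image AffineMap.lineMap_continuous

theorem continuousOn_nearest_edgePolygon : ContinuousOn (nearest M) (edgePolygon S ε) := by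
  rintro x (hx | ⟨p, q, he, hx⟩)
  · exact (h.continuousAt_nearest (hS hx) (by rw [dist_self]; exact h.pos)).continuousWithinAt
  · exact (h.continuousAt_nearest_of_mem_segment (hS he.left_mem) (hS he.right_mem) he.dist_lt
      hx).continuousWithinAt

/-- The image is open and closed in `M`, and the projected chord from `m` to a covering sample is a
connected subset of `M` meeting it. This reaches every component of `M`. -/
theorem image_nearest_edgePolygon (hSfin : S.Finite) (hcover : M ⊆ ballUnion S ε) :
    M ⊆ nearest M '' edgePolygon S ε := by
  intro m hm
  have hε := h.pos
  obtain ⟨s, hs, hms⟩ := mem_ballUnion.1 (hcover hm)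
  have hd : dist m s < 2 * ε := by linarith
  exact (h.isPreconnected_projectedArc hm (hS hs) hd).subset_of_mem_nhdsWithin
    (h.projectedArc_subset hm)
    (fun y hy => h.image_edgePolygon_mem_nhdsWithin hS hSfin hcover hy)
    ((isCompact_edgePolygon hSfin).image_of_continuousOn
      (h.continuousOn_nearest_edgePolygon hS)).isClosed subset_rfl Set.inter_subset_left
    ⟨s, h.right_mem_projectedArc (hS hs), s, Or.inl hs, h.nearest_self (hS hs)⟩
    (h.left_mem_projectedArc hm)

theorem nonempty_homeomorph_edgePolygon (hSfin : S.Finite) (hcover : M ⊆ ballUnion S ε) :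
    Nonempty (edgePolygon S ε ≃ₜ M) := by
  have hmem : ∀ x ∈ edgePolygon S ε, nearest M x ∈ M := by
    rintro x (hx | ⟨p, q, he, -⟩)
    exacts [h.nearest_mem (hS hx), h.nearest_mem (hS he.left_mem)]
  have hbij : Set.BijOn (nearest M) (edgePolygon S ε) M :=
    ⟨hmem, h.injOn_nearest_edgePolygon hS, h.image_nearest_edgePolygon hS hSfin hcover⟩
  have : CompactSpace (edgePolygon S ε) :=
    isCompact_iff_compactSpace.1 (isCompact_edgePolygon hSfin)
  exact ⟨Continuous.homeoOfEquivCompactToT2 (f := hbij.equiv (nearest M))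
    ((h.continuousOn_nearest_edgePolygon hS).mapsToRestrict hmem)⟩

end HasTangentReach

theorem theorem3 (M : Set Plane) (hM : IsCompact M) (hcurve : IsSmoothCurve M)
    (ε : ℝ) (hε : 0 < ε) (hετ : ENNReal.ofReal ε ≤ injectivityRadius M)
    (S : Set Plane) (hSfin : S.Finite) (hSM : S ⊆ M) (hcover : M ⊆ ballUnion S ε) :
    Nonempty (medialAxis (ballUnion S ε) ≃ₜ M) := by
  obtain ⟨T, h⟩ := exists_hasTangentReach hM hcurve hε hετ
  rw [h.medialAxis_eq_edgePolygon hSM hSfin]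
  exact h.nonempty_homeomorph_edgePolygon hSM hSfin hcover
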